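/- **Setting.** A seller of a freely replicable good faces a finite set $N$ of bidders. Bidder $i$'s private type is $t_i=(v_i,(\eta_{j\leftarrow i})_{j\ne i})$, where $v_i\in[\underline v_i,\overline v_i]$ is her value ($0\le\underline v_i<\overline v_i$) and $\eta_{j\leftarrow i}\ge 0$, lying in a bounded interval, is the externality she exerts on bidder $j$; $T_i$ is the box of her possible types. At allocation $x\in[0,1]^N$ and payments $p\in\mathbb R_{\ge0}^N$ bidder $i$'s utility is $v_ix_i-\sum_{j\neq i}\eta_{i\leftarrow j}x_j-p_i$. A mechanism $(x,p)$ maps bid profiles, in which each bidder reports a type or abstains, to allocations and payments (with finite interim expected payments); an abstaining bidder gets nothing and pays nothing. It is feasible if it is Bayes–Nash incentive compatible and interim individually rational (for every type in $T_i$, given that the others participate and bid truthfully). $\mathrm{rev}(x,p)$ is its expected total payment under truthful bidding. **Assumptions on the prior.** Types are independent across bidders, and for each $i$ the value $v_i$ is independent of $(\eta_{j\leftarrow i})_{j\neq i}$. The value $v_i$ has a density $f_i$ on $[\underline v_i,\overline v_i]$ with distribution function $F_i$. The means $m_{i\leftarrow j}=\mathbb E[\eta_{i\leftarrow j}]$ and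 the boxes $T_i$ are known to the seller, but the prior is otherwise unknown. With $S_i=\sum_{j\ne i}m_{j\leftarrow i}$, the function $v\mapsto v f_i(v)-(1-F_i(v))-f_i(v)S_i$ is non-decreasing on $[\underline v_i,\overline v_i]$. **Algorithm.** The posted-threshold mechanism with thresholds $\theta$ gives the good to $i$ iff $X_i=\mathbf 1\{v_i\ge\theta_i\}$ equals $1$ and charges $\theta_iX_i+\sum_{j\ne i}m_{i\leftarrow j}(1-X_j)$; if some bidder abstains, all participating bidders receive the good. Let $H_i(\theta,X)=\theta-(1-X)(\theta-S_i)$. Given $\delta,\gamma>0$ with $2\delta\le\overline v_i-\underline v_i$ for all $i$ and initial $\tau_i^1\in[\underline v_i+\delta,\overline v_i-\delta]$, at each step $k\ge1$ draw a fresh type profile $t^k$ from the prior and independent noises $u_i^k$ uniform on $[-1,1]$ (independent of the types, across bidders, and across steps), post the thresholds $\tau_i^k+\delta u_i^k$, observe $X_i^k=\mathbf 1\{v_i^k\ge\tau_i^k+\delta u_i^k\}$, and update $$\tau_i^{k+1}=\Pi_{[\underline v_i+\delta,\,\overline v_i-\delta]}\Big(\tau_i^k+\gamma\,H_i(\tau_i^k+\delta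 u_i^k,X_i^k)\,\tfrac{u_i^k}{\delta}\Big),$$ where $\Pi_I$ is projection onto the interval $I$. Let $(x^k,p^k)$ be the mechanism posted at step $k$. **Claim.** There are choices $\delta=\delta_K$ and $\gamma=\gamma_K$, depending only on $K$ and on what the seller knows, such that for every prior satisfying the assumptions: a revenue-optimal feasible mechanism $(x^\star,p^\star)$ exists; almost surely all the mechanisms $(x^k,p^k)$ are feasible; and there is a constant $C$, depending on the market and the prior but not on $K$ or the initial thresholds, such that the algorithm run with $(\delta_K,\gamma_K)$ has expected regret $$\mathbb E[R(K)]=\mathbb E\Big[\sum_{k=1}^K\big(\mathrm{rev}(x^\star,p^\star)-\mathrm{rev}(x^k,p^k)\big)\Big]\le C\,K^{3/4}\qquad\text{for all }K\ge1 .$$ -/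

import Mathlib

open MeasureTheory ProbabilityTheory
open scoped ENNReal

noncomputable section

namespace DataAuction

variable {N : Type*} [Fintype N] [DecidableEq N]

/-- What the seller knows about the bidders `N`.  The type of bidder `j` is a vector `s : N → ℝ`:
`s j` is her value `v_j` for the good and, for `i ≠ j`, `s i` is the externality `η_{i←j}` that she
exerts on bidder `i`.  Types of bidder `j` lie in the box `[lo j, hi j]`, and `meanExt i j` (for
`i ≠ j`) is the expectation of `η_{i←j}`. -/
structure Market (N : Type*) where
  lo : N → N → ℝ
  hi : N → N → ℝ
  meanExt : N → N → ℝ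
  lo_nonneg : ∀ i j, 0 ≤ lo i j
  val_lt : ∀ i, lo i i < hi i i

/-- The type space `T_i`. -/
def Market.typeSpace (E : Market N) (i : N) : Set (N → ℝ) := Set.Icc (E.lo i) (E.hi i)

/-- The mean total externality `∑_{j ≠ i} E[η_{j←i}]` that bidder `i` exerts on the others. -/
def Market.totalExt (E : Market N) (i : N) : ℝ := ∑ j ∈ Finset.univ.erase i, E.meanExt j i

/-- `D i` is the law of the type of bidder `i` (types of distinct bidders are independent).
It lives on `T_i`, the value is independent of the vector of exerted externalities, the latter
have the known means, the value has density `f i` on `[lo i i, hi i i]`, and the regularity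
condition holds: `v f(v) - (1 - F(v)) - f(v) ∑_{j ≠ i} E[η_{j←i}]` is non-decreasing. -/
structure IsRegularPrior (E : Market N) (D : N → Measure (N → ℝ)) (f : N → ℝ → ℝ) : Prop where
  isProb : ∀ i, IsProbabilityMeasure (D i)
  mem_typeSpace : ∀ i, ∀ᵐ s ∂(D i), s ∈ E.typeSpace i
  indep : ∀ i, IndepFun (fun s : N → ℝ => s i) (fun s (j : {j : N // j ≠ i}) => s j) (D i)
  mean_eq : ∀ i j, i ≠ j → ∫ s, s i ∂(D j) = E.meanExt i j
  measurable_density : ∀ i, Measurable (f i)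
  density_nonneg : ∀ i v, 0 ≤ f i v
  law_value : ∀ i, (D i).map (fun s => s i) =
    (volume.restrict (Set.Icc (E.lo i i) (E.hi i i))).withDensity (fun v => ENNReal.ofReal (f i v))
  regular : ∀ i, MonotoneOn
    (fun v => v * f i v - (1 - (D i).real {s | s i ≤ v}) - f i v * E.totalExt i)
    (Set.Icc (E.lo i i) (E.hi i i))

/-- A bid profile: every bidder reports a type, or `none` if she does not participate. -/
abbrev Bids (N : Type*) := N → Option (N → ℝ)

/-- The bid profile in which everybody participates and reports `t`. -/
def allIn (t : N → N → ℝ) : Bids N := fun i => some (t i)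

/-- Allocation and payment functions of a direct mechanism. -/
structure Mechanism (N : Type*) where
  alloc : Bids N → N → ℝ
  pay : Bids N → N → ℝ

/-- Allocations are in `[0,1]`, payments are nonnegative, bidders who stay out get nothing and pay
nothing, and the functions are measurable in the reports when at most one bidder stays out. -/
structure Mechanism.IsValid (M : Mechanism N) : Prop where
  alloc_mem : ∀ b i, M.alloc b i ∈ Set.Icc (0 : ℝ) 1
  pay_nonneg : ∀ b i, 0 ≤ M.pay b i
  out : ∀ b i, b i = none → M.alloc b i = 0 ∧ M.pay b i = 0
  measurable_alloc : Measurable fun t => M.alloc (allIn t)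
  measurable_pay : Measurable fun t => M.pay (allIn t)
  measurable_alloc_out : ∀ i, Measurable fun t => M.alloc (Function.update (allIn t) i none)
  measurable_pay_out : ∀ i, Measurable fun t => M.pay (Function.update (allIn t) i none)

/-- Net utility `v_i x_i - ∑_{j ≠ i} η_{i←j} x_j - p_i` of bidder `i` at the true types `t`. -/
def utility (i : N) (x p : N → ℝ) (t : N → N → ℝ) : ℝ :=
  t i i * x i - (∑ j ∈ Finset.univ.erase i, t j i * x j) - p i

/-- Interim expected utility `V_i(b; s)` of bidder `i` if she bids `b`, her true type is `s`, and
all other bidders report their types truthfully; the types of the other bidders are independent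
of hers. -/
def interimUtility (D : N → Measure (N → ℝ)) (M : Mechanism N) (i : N)
    (b : Option (N → ℝ)) (s : N → ℝ) : ℝ :=
  ∫ t, utility i (M.alloc (Function.update (allIn t) i b)) (M.pay (Function.update (allIn t) i b))
    (Function.update t i s) ∂(Measure.pi D)

/-- Bayes-Nash incentive compatibility. -/
def IsBNIC (E : Market N) (D : N → Measure (N → ℝ)) (M : Mechanism N) : Prop :=
  ∀ i, ∀ s ∈ E.typeSpace i, ∀ r ∈ E.typeSpace i,
    interimUtility D M i (some r) s ≤ interimUtility D M i (some s) s

/-- Interim individual rationality. -/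
def IsInterimIR (E : Market N) (D : N → Measure (N → ℝ)) (M : Mechanism N) : Prop :=
  ∀ i, ∀ s ∈ E.typeSpace i, interimUtility D M i none s ≤ interimUtility D M i (some s) s

/-- A valid mechanism that is BNIC and interim IR.  Interim payments are required to be finite, so
that interim utilities are genuine expectations (with payments `≥ 0`, an infinite interim payment
means interim utility `-∞`, which interim IR excludes anyway). -/
structure IsFeasible (E : Market N) (D : N → Measure (N → ℝ)) (M : Mechanism N) : Prop where
  valid : M.IsValid
  integrable_pay : ∀ i, ∀ r ∈ E.typeSpace i,
    Integrable (fun t => M.pay (Function.update (allIn t) i (some r)) i) (Measure.pi D)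
  bnic : IsBNIC E D M
  ir : IsInterimIR E D M

/-- Expected revenue when all bidders participate and are truthful. -/
def revenue (D : N → Measure (N → ℝ)) (M : Mechanism N) : ℝ :=
  ∫ t, ∑ i, M.pay (allIn t) i ∂(Measure.pi D)

/-- `M` is a revenue-optimal BNIC and interim IR mechanism. -/
def IsRevenueOptimal (E : Market N) (D : N → Measure (N → ℝ)) (M : Mechanism N) : Prop :=
  IsFeasible E D M ∧ ∀ M', IsFeasible E D M' → revenue D M' ≤ revenue D M

open Classical in
/-- Allocation of the posted-threshold mechanism: a participating bidder gets the good iff her value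
reaches her threshold; if somebody stays out, all participating bidders get it. -/
def postedAlloc (τ : N → ℝ) (b : Bids N) (i : N) : ℝ :=
  match b i with
  | none => 0
  | some s => if (∀ j, b j ≠ none) → τ i ≤ s i then 1 else 0

/-- The posted-threshold mechanism: participating bidders pay
`τ_i X_i + ∑_{j ≠ i} E[η_{i←j}] (1 - X_j)`, where `X` is the allocation. -/
def postedMechanism (E : Market N) (τ : N → ℝ) : Mechanism N where
  alloc := postedAlloc τ
  pay b i := match b i with
    | none => 0
    | some _ => τ i * postedAlloc τ b i +
        ∑ j ∈ Finset.univ.erase i, E.meanExt i j * (1 - postedAlloc τ b j)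

open Classical in
/-- The decision `X_i` of a bidder with value `v` who faces the price `p`. -/
def decision (p v : ℝ) : ℝ := if p ≤ v then 1 else 0

/-- The zeroth-order oracle `H_i(p, X) = p - (1 - X) (p - ∑_{j ≠ i} E[η_{j←i}])`. -/
def oracle (E : Market N) (i : N) (p X : ℝ) : ℝ := p - (1 - X) * (p - E.totalExt i)

/-- One-point gradient step for bidder `i`: from the current `τ` and noise `u`, where `X` is the
decision at the posted price `τ + δ u`, move to `τ + γ H_i(τ + δ u, X) u / δ`, projected on
`[lo i i + δ, hi i i - δ]` (so that the next posted price is in `[lo i i, hi i i]`). -/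
def gradientUpdate (E : Market N) (δ γ : ℝ) (i : N) (τ u X : ℝ) : ℝ :=
  max (E.lo i i + δ) (min (E.hi i i - δ) (τ + γ * oracle E i (τ + δ * u) X * u / δ))

/-- The iterates of the algorithm on the types `t k` and noises `u k` of the successive steps
`k = 0, 1, …`, starting from `τ₁`. -/
def iterate (E : Market N) (δ γ : ℝ) (τ₁ : N → ℝ) (t : ℕ → N → N → ℝ) (u : ℕ → N → ℝ) :
    ℕ → N → ℝ
  | 0 => τ₁
  | k + 1 => fun i =>
      let τ := iterate E δ γ τ₁ t u k i
      gradientUpdate E δ γ i τ (u k i) (decision (τ + δ * u k i) (t k i i))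

/-- The mechanism announced by the algorithm at step `k`: thresholds `τ^k + δ u^k` are posted. -/
def stepMechanism (E : Market N) (δ γ : ℝ) (τ₁ : N → ℝ) (t : ℕ → N → N → ℝ) (u : ℕ → N → ℝ)
    (k : ℕ) : Mechanism N :=
  postedMechanism E (fun i => iterate E δ γ τ₁ t u k i + δ * u k i)

/-- The uniform distribution on `[-1,1]`. -/
def unif : Measure ℝ := (2⁻¹ : ℝ≥0∞) • volume.restrict (Set.Icc (-1) 1)

/-- `t k` and `u k` are the type profile and the exploration noises of step `k`: the noises are
independent and uniform on `[-1,1]`, the types have law `∏ D i`, types and noises are independent,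
and steps are independent of each other. -/
structure IsSampling {Ω : Type*} [MeasurableSpace Ω] (P : Measure Ω) (D : N → Measure (N → ℝ))
    (t : ℕ → Ω → N → N → ℝ) (u : ℕ → Ω → N → ℝ) : Prop where
  measurable_types : ∀ k, Measurable (t k)
  measurable_noise : ∀ k, Measurable (u k)
  law : ∀ k, P.map (fun ω => (t k ω, u k ω)) =
    (Measure.pi D).prod (Measure.pi fun _ : N => unif)
  indep : iIndepFun (fun k ω => (t k ω, u k ω)) P

/-- The regret `R(K) = ∑_{k ≤ K} (rev(x*, p*) - rev(x^k, p^k))` of a sequence of mechanisms. -/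
def regret (D : N → Measure (N → ℝ)) (Mstar : Mechanism N) (M : ℕ → Mechanism N) (K : ℕ) : ℝ :=
  ∑ k ∈ Finset.range K, (revenue D Mstar - revenue D (M k))

end DataAuction

end

/-! Fix bidder `i`, with value law `ν` on `[a, b]` and mean exerted externality `S`. The
externalities that she exerts do not enter her own utility, so incentive compatibility makes her
interim allocation a subgradient of her rent in the value alone (`incentive_inequality`). Hence her
rent depends only on her value, and almost surely so does her allocation (`interimAlloc_ae_eq`).
Staying out costs her at most the mean externalities that she suffers, which bounds her rent below
(`integral_interimUtility_ge`). In total revenue the externalities can be charged to the bidder who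
exerts them. The problem then splits into one screening problem per bidder, each solved by a posted
price (`exists_optimal_price`), and the posted-threshold mechanism attains the sum of these optima
(`revenue_le_of_isFeasible`, `revenue_postedMechanism`).

The regret is therefore a sum over bidders of losses of `G p = (p - S) ν[p, ∞)`. By Myerson's
identity `G` is the integral over `[p, b]` of the virtual density. Regularity makes that density
monotone, so `G` is concave and Lipschitz.

The oracle at price `p` has mean `G p + S`. Since the noise is centred, the expected step at `τ`
equals the mean of `(G (τ + δ u) - G τ) u`, up to the factor `γ / δ` and the projection. By
concavity it points towards any `θ` in proportion to `G θ - G τ`, up to an error of order `δ`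
(`one_point_inequality`). Expanding the squared distance to `θ` and telescoping gives regret of
order `K δ + K γ / δ² + 1 / γ`, which is `K^(3/4)` for `δ ∼ K^(-1/4)` and `γ = K^(-3/4)`. -/

noncomputable section

namespace DataAuction

set_option linter.unusedSectionVars false

/-! ### Virtual values and the revenue of a posted price -/

section PostedPrice

variable {a b S : ℝ} {f : ℝ → ℝ} {ν : Measure ℝ}

/-- Revenue net of externalities `(p - S) ℙ(v ≥ p)` of the posted price `p`. -/
def netRevenue (ν : Measure ℝ) (S p : ℝ) : ℝ := (p - S) * ν.real (Set.Ici p)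

/-- The virtual value weighted by the density. -/
def virtualDensity (ν : Measure ℝ) (f : ℝ → ℝ) (S v : ℝ) : ℝ :=
  v * f v - (1 - ν.real (Set.Iic v)) - f v * S

/-- `ν` has density `f` on `[a, b]`. -/
structure HasDensityOn (ν : Measure ℝ) (f : ℝ → ℝ) (a b : ℝ) : Prop where
  lt : a < b
  measurable : Measurable f
  nonneg : ∀ v, 0 ≤ f v
  eq : ν = (volume.restrict (Set.Icc a b)).withDensity fun v => ENNReal.ofReal (f v)

lemma HasDensityOn.absolutelyContinuous (h : HasDensityOn ν f a b) : ν ≪ volume := by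
  rw [h.eq]
  exact (withDensity_absolutelyContinuous _ _).trans Measure.restrict_le_self.absolutelyContinuous

lemma HasDensityOn.nullSingletonClass (h : HasDensityOn ν f a b) : NullSingletonClass ν :=
  ⟨fun _ => h.absolutelyContinuous (measure_singleton _)⟩

lemma HasDensityOn.ae_mem (h : HasDensityOn ν f a b) : ∀ᵐ v ∂ν, v ∈ Set.Icc a b := by
  have : ν ≪ volume.restrict (Set.Icc a b) := by
    rw [h.eq]; exact withDensity_absolutelyContinuous _ _
  exact this.ae_le (ae_restrict_mem measurableSet_Icc)

lemma HasDensityOn.integral_eq (h : HasDensityOn ν f a b) (g : ℝ → ℝ) :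
    ∫ v, g v ∂ν = ∫ v in a..b, f v * g v := by
  rw [intervalIntegral.integral_of_le h.lt.le, ← integral_Icc_eq_integral_Ioc]
  conv_lhs => rw [h.eq]
  rw [integral_withDensity_eq_integral_toReal_smul h.measurable.ennreal_ofReal (by simp)]
  refine integral_congr_ae (.of_forall fun v => ?_)
  simp [ENNReal.toReal_ofReal (h.nonneg v)]

lemma HasDensityOn.integrable_mul_iff (h : HasDensityOn ν f a b) (g : ℝ → ℝ) :
    IntervalIntegrable (fun v => f v * g v) volume a b ↔ Integrable g ν := by
  rw [intervalIntegrable_iff_integrableOn_Icc_of_le h.lt.le]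
  conv_rhs => rw [h.eq]
  rw [integrable_withDensity_iff_integrable_smul' h.measurable.ennreal_ofReal (by simp)]
  refine integrable_congr (.of_forall fun v => ?_)
  simp [ENNReal.toReal_ofReal (h.nonneg v)]

lemma integrable_of_measurable_of_ae_bound {α : Type*} [MeasurableSpace α] {μ : Measure α}
    [IsFiniteMeasure μ] {g : α → ℝ} (hg : Measurable g) (c : ℝ) (hc : ∀ᵐ x ∂μ, |g x| ≤ c) :
    Integrable g μ :=
  .of_bound hg.aestronglyMeasurable c (by simpa using hc)

lemma HasDensityOn.measureReal_Ici (h : HasDensityOn ν f a b) [IsProbabilityMeasure ν] (p : ℝ) :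
    ν.real (Set.Ici p) = 1 - ν.real (Set.Iic p) := by
  have := h.nullSingletonClass
  rw [← measureReal_congr Ioi_ae_eq_Ici, ← Set.compl_Iic, probReal_compl_eq_one_sub measurableSet_Iic]

/-- Myerson's identity: revenue as expected virtual value. -/
lemma integral_virtualDensity [IsProbabilityMeasure ν] (h : HasDensityOn ν f a b) {x : ℝ → ℝ}
    (hx : Measurable x) (hx01 : ∀ v, x v ∈ Set.Icc (0 : ℝ) 1) :
    IntervalIntegrable (fun v => x v * virtualDensity ν f S v) volume a b ∧
    ∫ v, (v - S) * x v ∂ν - ∫ v, (∫ w in a..v, x w) ∂ν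
      = ∫ v in a..b, x v * virtualDensity ν f S v := by
  have hxb : ∀ v, |x v| ≤ 1 := fun v => abs_le.2 ⟨by linarith [(hx01 v).1], (hx01 v).2⟩
  have hi1 : Integrable (fun v => (v - S) * x v) ν := by
    refine integrable_of_measurable_of_ae_bound (by fun_prop) (|a| + |b| + |S|) ?_
    filter_upwards [h.ae_mem] with v hv
    rw [abs_mul]
    have h1 : |v - S| ≤ |a| + |b| + |S| := by
      refine (abs_sub _ _).trans ?_
      have := abs_le_max_abs_abs hv.1 hv.2
      have := max_le_add_of_nonneg (abs_nonneg a) (abs_nonneg b)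
      linarith
    calc _ ≤ |v - S| * 1 := by gcongr; exact hxb v
      _ ≤ _ := by simpa using h1
  have hmR : Measurable fun v => ν.real (Set.Ici v) :=
    Antitone.measurable fun p q hpq => measureReal_mono (Set.Ici_subset_Ici.2 hpq)
  have hi2 : IntervalIntegrable (fun v => x v * ν.real (Set.Ici v)) volume a b := by
    rw [intervalIntegrable_iff_integrableOn_Icc_of_le h.lt.le]
    refine integrable_of_measurable_of_ae_bound (by fun_prop) 1 (.of_forall fun v => ?_)
    rw [abs_mul, abs_of_nonneg measureReal_nonneg]
    exact mul_le_one₀ (hxb v) measureReal_nonneg measureReal_le_one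
  have hi1' := (h.integrable_mul_iff _).2 hi1
  -- Fubini on the triangle `w ≤ v`: the allocation at `w` is paid as rent to all values above `w`.
  have key : ∫ v, (∫ w in a..v, x w) ∂ν = ∫ w in a..b, x w * ν.real (Set.Ici w) := by
    have e1 : ∫ v, (∫ w in a..v, x w) ∂ν
        = ∫ v, (∫ w in Set.Ioc a b, (Set.Iic v).indicator x w) ∂ν := by
      refine integral_congr_ae ?_
      filter_upwards [h.ae_mem] with v hv
      rw [intervalIntegral.integral_of_le hv.1, setIntegral_indicator measurableSet_Iic]
      congr 2
      ext w
      simp only [Set.mem_Ioc, Set.mem_inter_iff, Set.mem_Iic]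
      constructor
      · rintro ⟨h1, h2⟩; exact ⟨⟨h1, h2.trans hv.2⟩, h2⟩
      · rintro ⟨⟨h1, _⟩, h2⟩; exact ⟨h1, h2⟩
    rw [e1, integral_integral_swap, intervalIntegral.integral_of_le h.lt.le]
    · refine integral_congr_ae (.of_forall fun w => ?_)
      have : (fun v => (Set.Iic v).indicator x w) = (Set.Ici w).indicator fun _ => x w := by
        ext v; simp [Set.indicator_apply]
      simp only [this]
      rw [integral_indicator_const _ measurableSet_Ici, smul_eq_mul, mul_comm]
    · have hm : Measurable (Function.uncurry fun v w => (Set.Iic v).indicator x w) := by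
        have : (Function.uncurry fun v w => (Set.Iic v).indicator x w)
            = {q : ℝ × ℝ | q.2 ≤ q.1}.indicator fun q => x q.2 := by
          ext q; simp [Set.indicator_apply, Function.uncurry]
        rw [this]
        exact (hx.comp measurable_snd).indicator (measurableSet_le measurable_snd measurable_fst)
      refine integrable_of_measurable_of_ae_bound hm 1 (.of_forall fun q => ?_)
      simp only [Function.uncurry, Set.indicator_apply]
      split_ifs
      · exact hxb _
      · simp
  have e : ∀ v, x v * virtualDensity ν f S v
      = f v * ((v - S) * x v) - x v * ν.real (Set.Ici v) := by
    intro v; rw [virtualDensity, h.measureReal_Ici]; ring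
  simp only [e]
  refine ⟨hi1'.sub hi2, ?_⟩
  rw [intervalIntegral.integral_sub hi1' hi2, ← h.integral_eq, key]

/-- Myerson's identity for the rule `1{v ≥ y}`: its rent is `(v - y)⁺`, and `(v - S) - (v - y) = y -
S` on a sale. -/
lemma netRevenue_eq_integral [IsProbabilityMeasure ν] (h : HasDensityOn ν f a b) {y : ℝ}
    (hy : y ∈ Set.Icc a b) : netRevenue ν S y = ∫ v in y..b, virtualDensity ν f S v := by
  have hx : Measurable ((Set.Ici y).indicator fun _ => (1 : ℝ)) :=
    measurable_const.indicator measurableSet_Ici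
  have h1 := integral_virtualDensity (S := S) h hx fun v => by
    by_cases hv : v ∈ Set.Ici y <;> simp [hv]
  have e1 : ∫ v in a..b, (Set.Ici y).indicator (fun _ => (1 : ℝ)) v * virtualDensity ν f S v
      = ∫ v in y..b, virtualDensity ν f S v := by
    rw [intervalIntegral.integral_of_le h.lt.le, intervalIntegral.integral_of_le hy.2,
      ← integral_Icc_eq_integral_Ioc, ← integral_Icc_eq_integral_Ioc]
    have : ∀ v, (Set.Ici y).indicator (fun _ => (1 : ℝ)) v * virtualDensity ν f S v
        = (Set.Ici y).indicator (virtualDensity ν f S) v := by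
      intro v; by_cases hv : v ∈ Set.Ici y <;> simp [hv]
    simp only [this]
    rw [setIntegral_indicator measurableSet_Ici]
    congr 2
    ext v
    simp only [Set.mem_inter_iff, Set.mem_Icc, Set.mem_Ici]
    constructor
    · rintro ⟨⟨_, h2⟩, h3⟩; exact ⟨h3, h2⟩
    · rintro ⟨h1, h2⟩; exact ⟨⟨hy.1.trans h1, h2⟩, h1⟩
  have e2 : ∀ᵐ v ∂ν, (∫ w in a..v, (Set.Ici y).indicator (fun _ => (1 : ℝ)) w)
      = (Set.Ici y).indicator (fun v => v - y) v := by
    filter_upwards [h.ae_mem] with v hv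
    rw [intervalIntegral.integral_of_le hv.1, ← integral_Icc_eq_integral_Ioc,
      setIntegral_indicator measurableSet_Ici]
    have : Set.Icc a v ∩ Set.Ici y = Set.Icc y v := by
      ext w
      simp only [Set.mem_inter_iff, Set.mem_Icc, Set.mem_Ici]
      constructor
      · rintro ⟨⟨_, h2⟩, h3⟩; exact ⟨h3, h2⟩
      · rintro ⟨h1, h2⟩; exact ⟨⟨hy.1.trans h1, h2⟩, h1⟩
    rw [this]
    by_cases hvy : y ≤ v
    · simp [hvy]
    · simp [hvy]
  rw [← e1, ← h1.2, integral_congr_ae e2, ← integral_sub]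
  · have : ∀ v, (v - S) * (Set.Ici y).indicator (fun _ => (1 : ℝ)) v
        - (Set.Ici y).indicator (fun v => v - y) v = (Set.Ici y).indicator (fun _ => y - S) v := by
      intro v; by_cases hv : v ∈ Set.Ici y <;> simp [hv]
    simp only [this]
    rw [integral_indicator_const _ measurableSet_Ici, netRevenue, smul_eq_mul, mul_comm]
  · refine integrable_of_measurable_of_ae_bound (by fun_prop) (|a| + |b| + |S|) ?_
    filter_upwards [h.ae_mem] with v hv
    have h1 : |v - S| ≤ |a| + |b| + |S| := by
      refine (abs_sub _ _).trans ?_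
      have := abs_le_max_abs_abs hv.1 hv.2
      have := max_le_add_of_nonneg (abs_nonneg a) (abs_nonneg b)
      linarith
    by_cases hvy : v ∈ Set.Ici y
    · simpa [hvy] using h1
    · simp only [hvy, not_false_eq_true, Set.indicator_of_notMem, mul_zero, abs_zero]; positivity
  · refine integrable_of_measurable_of_ae_bound
      ((measurable_id.sub_const y).indicator measurableSet_Ici) (b - a) ?_
    filter_upwards [h.ae_mem] with v hv
    by_cases hvy : v ∈ Set.Ici y
    · have h3 : y ≤ v := hvy
      rw [Set.indicator_of_mem hvy, abs_of_nonneg (sub_nonneg.2 h3)]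
      change v - y ≤ b - a
      linarith [hv.2, hy.1]
    · simp only [hvy, not_false_eq_true, Set.indicator_of_notMem, abs_zero]
      linarith [h.lt]

/-- Concavity without differentiating: a monotone integrand is compared with its value at `y`, on
either side of `y`. -/
lemma netRevenue_supergradient [IsProbabilityMeasure ν] (h : HasDensityOn ν f a b)
    (hreg : MonotoneOn (virtualDensity ν f S) (Set.Icc a b)) {y z : ℝ}
    (hy : y ∈ Set.Icc a b) (hz : z ∈ Set.Icc a b) :
    netRevenue ν S z ≤ netRevenue ν S y - virtualDensity ν f S y * (z - y) := by
  have hint : ∀ p ∈ Set.Icc a b, ∀ q ∈ Set.Icc a b,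
      IntervalIntegrable (virtualDensity ν f S) volume p q := fun p hp q hq =>
    (hreg.mono (Set.uIcc_subset_Icc hp hq)).intervalIntegrable
  have hb : b ∈ Set.Icc a b := Set.right_mem_Icc.2 h.lt.le
  rw [netRevenue_eq_integral h hz, netRevenue_eq_integral h hy,
    ← intervalIntegral.integral_add_adjacent_intervals (hint y hy z hz) (hint z hz b hb)]
  suffices virtualDensity ν f S y * (z - y) ≤ ∫ v in y..z, virtualDensity ν f S v by linarith
  rcases le_total y z with hyz | hyz
  · have := intervalIntegral.integral_mono_on hyz intervalIntegrable_const (hint y hy z hz)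
      fun v hv => hreg hy ⟨hy.1.trans hv.1, hv.2.trans hz.2⟩ hv.1
    simpa [mul_comm] using this
  · have := intervalIntegral.integral_mono_on hyz (hint z hz y hy) intervalIntegrable_const
      fun v hv => hreg ⟨hz.1.trans hv.1, hv.2.trans hy.2⟩ hy hv.2
    rw [intervalIntegral.integral_symm]
    simp at this
    linarith

/-- Supplies the Lipschitz constant of the net revenue; monotonicity replaces any bound on the
density. -/
lemma abs_virtualDensity_le (hab : a ≤ b)
    (hreg : MonotoneOn (virtualDensity ν f S) (Set.Icc a b)) {y : ℝ} (hy : y ∈ Set.Icc a b) :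
    |virtualDensity ν f S y| ≤ |virtualDensity ν f S a| + |virtualDensity ν f S b| := by
  have h1 := hreg (Set.left_mem_Icc.2 hab) hy hy.1
  have h2 := hreg hy (Set.right_mem_Icc.2 hab) hy.2
  exact (abs_le_max_abs_abs h1 h2).trans (max_le_add_of_nonneg (abs_nonneg _) (abs_nonneg _))

/-- A best posted price earns at least as much as any allocation rule. -/
lemma exists_optimal_price [IsProbabilityMeasure ν] (h : HasDensityOn ν f a b)
    (hreg : MonotoneOn (virtualDensity ν f S) (Set.Icc a b)) :
    ∃ θ ∈ Set.Icc a b, ∀ x : ℝ → ℝ, Measurable x → (∀ v, x v ∈ Set.Icc (0 : ℝ) 1) →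
      ∫ v, (v - S) * x v ∂ν - ∫ v, (∫ w in a..v, x w) ∂ν ≤ netRevenue ν S θ := by
  have hab := h.lt.le
  have hb : b ∈ Set.Icc a b := Set.right_mem_Icc.2 hab
  -- Inserting `b` covers a virtual density that is negative throughout, when the best price is `b`.
  -- The infimum need not lie in `A`, so signs are used only on open intervals below.
  set A : Set ℝ := insert b {v ∈ Set.Icc a b | 0 ≤ virtualDensity ν f S v} with hA
  have hAne : A.Nonempty := Set.insert_nonempty _ _
  have hAsub : ∀ v ∈ A, v ∈ Set.Icc a b := by
    rintro v (rfl | hv)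
    exacts [hb, hv.1]
  have hAb : BddBelow A := ⟨a, fun v hv => (hAsub v hv).1⟩
  have hθ : sInf A ∈ Set.Icc a b :=
    ⟨le_csInf hAne fun v hv => (hAsub v hv).1, csInf_le hAb (Set.mem_insert _ _)⟩
  have hint : ∀ p ∈ Set.Icc a b, ∀ q ∈ Set.Icc a b,
      IntervalIntegrable (virtualDensity ν f S) volume p q := fun p hp q hq =>
    (hreg.mono (Set.uIcc_subset_Icc hp hq)).intervalIntegrable
  refine ⟨sInf A, hθ, fun x hx hx01 => ?_⟩
  obtain ⟨hxi, hxe⟩ := integral_virtualDensity (S := S) h hx hx01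
  have hxi1 := hxi.mono_set (Set.uIcc_subset_uIcc Set.left_mem_uIcc (Set.mem_uIcc_of_le hθ.1 hθ.2))
  have hxi2 := hxi.mono_set (Set.uIcc_subset_uIcc (Set.mem_uIcc_of_le hθ.1 hθ.2) Set.right_mem_uIcc)
  rw [hxe, netRevenue_eq_integral h hθ,
    ← intervalIntegral.integral_add_adjacent_intervals hxi1 hxi2]
  have h1 : ∫ v in a..sInf A, x v * virtualDensity ν f S v ≤ ∫ v in a..sInf A, (0 : ℝ) := by
    refine intervalIntegral.integral_mono_on_of_le_Ioo hθ.1 hxi1 intervalIntegrable_const ?_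
    intro v hv
    refine mul_nonpos_of_nonneg_of_nonpos (hx01 v).1 ?_
    by_contra! hc
    exact absurd (csInf_le hAb (Or.inr ⟨⟨hv.1.le, hv.2.le.trans hθ.2⟩, hc.le⟩)) (not_le.2 hv.2)
  have h2 : ∫ v in sInf A..b, x v * virtualDensity ν f S v
      ≤ ∫ v in sInf A..b, virtualDensity ν f S v := by
    refine intervalIntegral.integral_mono_on_of_le_Ioo hθ.2 hxi2 (hint _ hθ _ hb) ?_
    intro v hv
    obtain ⟨w, hw, hwv⟩ := (csInf_lt_iff hAb hAne).1 hv.1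
    have hwφ : 0 ≤ virtualDensity ν f S w := by
      rcases hw with rfl | hw
      · exact absurd hwv (not_lt.2 hv.2.le)
      · exact hw.2
    have := hwφ.trans (hreg (hAsub w hw) ⟨hθ.1.trans hv.1.le, hv.2.le⟩ hwv.le)
    exact mul_le_of_le_one_left this (hx01 v).2
  simp only [intervalIntegral.integral_zero] at h1
  linarith

end PostedPrice

/-! ### Envelope inequalities -/

/-- If `x` is a monotone family of subgradients of `U`, then `U` dominates the integral of `x`. -/
lemma add_integral_le_of_subgradient {a b : ℝ} {U x : ℝ → ℝ} (hx : Monotone x)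
    (hU : ∀ v ∈ Set.Icc a b, ∀ w ∈ Set.Icc a b, (v - w) * x w ≤ U v - U w)
    {v : ℝ} (hv : v ∈ Set.Icc a b) : U a + ∫ w in a..v, x w ≤ U v := by
  have hint : ∀ p q, IntervalIntegrable x volume p q := fun p q => hx.intervalIntegrable
  -- Cut `[a, v]` into `n + 1` equal cells. On each, `x` is at most its right-end value, while `U`
  -- grows at least at the left-end rate. The discrepancies telescope.
  have key : ∀ n : ℕ, (∫ w in a..v, x w) - (U v - U a) ≤ (v - a) * (x v - x a) / (n + 1) := by
    intro n
    set h : ℝ := (v - a) / (n + 1) with hh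
    have hn : (0 : ℝ) < n + 1 := by positivity
    have hh0 : 0 ≤ h := div_nonneg (by linarith [hv.1]) hn.le
    set p : ℕ → ℝ := fun k => a + k * h with hp
    have hp0 : p 0 = a := by simp [hp]
    have hpn : p (n + 1) = v := by
      simp only [hp, hh]; push_cast; field_simp; ring
    have hstep : ∀ k, p (k + 1) - p k = h := by intro k; simp only [hp]; push_cast; ring
    have hmono : Monotone p := monotone_nat_of_le_succ fun k => by linarith [hstep k]
    have hmem : ∀ k ≤ n + 1, p k ∈ Set.Icc a b := fun k hk =>
      ⟨hp0 ▸ hmono (Nat.zero_le k), (hmono hk).trans (hpn ▸ hv.2)⟩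
    have hbound : ∀ k ∈ Finset.range (n + 1), ∫ w in p k..p (k + 1), x w
        ≤ (U (p (k + 1)) - U (p k)) + h * (x (p (k + 1)) - x (p k)) := by
      intro k hk
      have hk' : k + 1 ≤ n + 1 := Finset.mem_range.1 hk
      have h1 := intervalIntegral.integral_mono_on (hmono k.le_succ) (hint _ _)
        (intervalIntegrable_const (c := x (p (k + 1)))) fun w hw => hx hw.2
      have h2 := hU _ (hmem _ hk') _ (hmem k (by omega))
      simp only [intervalIntegral.integral_const, smul_eq_mul] at h1
      rw [hstep] at h1 h2
      linarith
    have := Finset.sum_le_sum hbound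
    rw [intervalIntegral.sum_integral_adjacent_intervals fun k _ => hint _ _,
      Finset.sum_add_distrib, ← Finset.mul_sum, Finset.sum_range_sub (fun k => U (p k)),
      Finset.sum_range_sub (fun k => x (p k)), hp0, hpn] at this
    have e : (v - a) * (x v - x a) / (n + 1) = h * (x v - x a) := by rw [hh]; ring
    linarith
  have hlim : Filter.Tendsto (fun n : ℕ => (v - a) * (x v - x a) / ((n : ℝ) + 1)) Filter.atTop
      (nhds 0) := by
    have := tendsto_one_div_add_atTop_nhds_zero_nat (𝕜 := ℝ)
    simpa [div_eq_mul_inv] using this.const_mul ((v - a) * (x v - x a))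
  have := ge_of_tendsto' hlim key
  linarith

/-! ### A one-parameter family of types -/

section LeastType

variable {N : Type*} [DecidableEq N]

/-- The type of bidder `i` with the least externalities and value `v` (truncated to the type
space). -/
def Market.leastType (E : Market N) (i : N) (v : ℝ) : N → ℝ :=
  Function.update (E.lo i) i (max (E.lo i i) (min (E.hi i i) v))

lemma Market.leastType_apply (E : Market N) (i : N) {v : ℝ} (hv : v ∈ Set.Icc (E.lo i i) (E.hi i i)) :
    E.leastType i v i = v := by
  simp [leastType, hv.1, hv.2]

/-- Nonemptiness supplies `lo ≤ hi` in the externality coordinates, which `Market` does not require.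
-/
lemma leastType_mem {E : Market N} {i : N} (hne : (E.typeSpace i).Nonempty) (v : ℝ) :
    E.leastType i v ∈ E.typeSpace i := by
  obtain ⟨s, hs⟩ := hne
  have hab := E.val_lt i
  constructor
  · intro j
    by_cases hj : j = i
    · subst hj; simp [Market.leastType]
    · simp [Market.leastType, hj]
  · intro j
    by_cases hj : j = i
    · subst hj; simp [Market.leastType, hab.le]
    · simpa [Market.leastType, hj] using (hs.1 j).trans (hs.2 j)

lemma monotone_leastType (E : Market N) (i : N) : Monotone fun v => E.leastType i v i := by
  intro v w hvw
  simp only [Market.leastType, Function.update_self]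
  gcongr

end LeastType

/-! ### Multidimensional types: only the value matters -/

section Envelope

variable {N : Type*} {E : Market N} {i : N} {X W : (N → ℝ) → ℝ}
variable (hXW : ∀ s ∈ E.typeSpace i, ∀ r ∈ E.typeSpace i, (s i - r i) * X r ≤ W s - W r)

include hXW

/-- Add the two incentive inequalities between `s` and `r`. Equal values give no such comparison:
there `X` may still depend on the reported externalities. -/
lemma rule_le_of_value_lt {s r : N → ℝ} (hs : s ∈ E.typeSpace i) (hr : r ∈ E.typeSpace i)
    (h : r i < s i) : X r ≤ X s := by
  have h1 := hXW s hs r hr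
  have h2 := hXW r hr s hs
  by_contra! hc
  nlinarith

lemma rent_eq_of_value_eq {s r : N → ℝ} (hs : s ∈ E.typeSpace i) (hr : r ∈ E.typeSpace i)
    (h : r i = s i) : W r = W s := by
  have h1 := hXW s hs r hr
  have h2 := hXW r hr s hs
  rw [h] at h1 h2
  linarith

variable [DecidableEq N]

lemma monotone_rule_leastType (hne : (E.typeSpace i).Nonempty) :
    Monotone fun v => X (E.leastType i v) := by
  intro v w hvw
  rcases (monotone_leastType E i hvw).lt_or_eq with h | h
  · exact rule_le_of_value_lt hXW (leastType_mem hne _) (leastType_mem hne _) h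
  · have : E.leastType i v = E.leastType i w := by
      ext j
      by_cases hj : j = i
      · subst hj; exact h
      · simp [Market.leastType, hj]
    simp [this]

/-- The rent of `s` is that of the least type with the same value, so the envelope inequality along
the family `leastType` suffices. -/
lemma rent_add_integral_le {s : N → ℝ} (hs : s ∈ E.typeSpace i) :
    W (E.leastType i (E.lo i i)) + ∫ w in E.lo i i..s i, X (E.leastType i w) ≤ W s := by
  have hne : (E.typeSpace i).Nonempty := ⟨s, hs⟩
  have hsi : s i ∈ Set.Icc (E.lo i i) (E.hi i i) := ⟨hs.1 i, hs.2 i⟩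
  have := add_integral_le_of_subgradient (U := fun v => W (E.leastType i v))
    (monotone_rule_leastType hXW hne) (fun v hv w hw => by
      have := hXW _ (leastType_mem hne v) _ (leastType_mem hne w)
      rwa [E.leastType_apply i hv, E.leastType_apply i hw] at this) hsi
  rwa [rent_eq_of_value_eq hXW hs (leastType_mem hne _) (E.leastType_apply i hsi)] at this

/-- `X s` is squeezed between the rule at least types of slightly smaller and slightly larger value.
So the externality report can matter only where the monotone rule jumps, or at the endpoints. -/
lemma rule_eq_of_continuousAt {s : N → ℝ} (hs : s ∈ E.typeSpace i)
    (hsi : s i ∈ Set.Ioo (E.lo i i) (E.hi i i))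
    (hc : ContinuousAt (fun v => X (E.leastType i v)) (s i)) :
    X s = X (E.leastType i (s i)) := by
  have hne : (E.typeSpace i).Nonempty := ⟨s, hs⟩
  apply le_antisymm
  · refine ge_of_tendsto (hc.tendsto.mono_left nhdsWithin_le_nhds : Filter.Tendsto _
      (nhdsWithin (s i) (Set.Ioi (s i))) _) ?_
    filter_upwards [Ioo_mem_nhdsGT hsi.2] with v hv
    refine rule_le_of_value_lt hXW (leastType_mem hne v) hs ?_
    rw [E.leastType_apply i ⟨hsi.1.le.trans hv.1.le, hv.2.le⟩]
    exact hv.1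
  · refine le_of_tendsto (hc.tendsto.mono_left nhdsWithin_le_nhds : Filter.Tendsto _
      (nhdsWithin (s i) (Set.Iio (s i))) _) ?_
    filter_upwards [Ioo_mem_nhdsLT hsi.1] with v hv
    refine rule_le_of_value_lt hXW hs (leastType_mem hne v) ?_
    rw [E.leastType_apply i ⟨hv.1.le, hv.2.le.trans hsi.2.le⟩]
    exact hv.2

end Envelope

variable {N : Type*} [Fintype N] [DecidableEq N]

/-! ### Resampling one coordinate of a product measure -/

section Resample

variable {X : N → Type*} [∀ i, MeasurableSpace (X i)] (D : ∀ i, Measure (X i))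
  [∀ i, IsProbabilityMeasure (D i)]

/-- Interim quantities integrate over whole profiles with coordinate `i` overwritten by the report.
Resampling that coordinate links them to ex ante expectations. -/
lemma measurePreserving_update (i : N) :
    MeasurePreserving (fun q : X i × (∀ j, X j) => Function.update q.2 i q.1)
      ((D i).prod (Measure.pi D)) (Measure.pi D) := by
  have hm : Measurable (fun q : X i × (∀ j, X j) => Function.update q.2 i q.1) :=
    measurable_update'.comp measurable_swap
  refine ⟨hm, (Measure.pi_eq fun s hs => ?_).symm⟩
  rw [Measure.map_apply hm (MeasurableSet.univ_pi hs)]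
  have : (fun q : X i × (∀ j, X j) => Function.update q.2 i q.1) ⁻¹' Set.univ.pi s
      = s i ×ˢ Set.univ.pi (Function.update s i Set.univ) := by
    ext q
    simp only [Set.mem_preimage, Set.mem_pi, Set.mem_univ, true_implies, Set.mem_prod]
    constructor
    · intro h
      refine ⟨by simpa using h i, fun j => ?_⟩
      by_cases hj : j = i
      · subst hj; simp
      · simpa [hj] using h j
    · rintro ⟨h1, h2⟩ j
      by_cases hj : j = i
      · subst hj; simpa using h1
      · simpa [hj] using h2 j
  rw [this, Measure.prod_prod, Measure.pi_pi, ← Finset.mul_prod_erase _ _ (Finset.mem_univ i),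
    ← Finset.mul_prod_erase _ (fun j => D j (s j)) (Finset.mem_univ i)]
  simp only [Function.update_self, measure_univ, one_mul]
  congr 1
  refine Finset.prod_congr rfl fun j hj => ?_
  rw [Function.update_of_ne (Finset.ne_of_mem_erase hj)]

variable {D}

lemma integrable_comp_update {g : (∀ j, X j) → ℝ} (hg : Integrable g (Measure.pi D)) (i : N) :
    Integrable (fun q : X i × (∀ j, X j) => g (Function.update q.2 i q.1))
      ((D i).prod (Measure.pi D)) :=
  (measurePreserving_update D i).integrable_comp_of_integrable hg

lemma integral_eq_integral_update {g : (∀ j, X j) → ℝ} (hg : Integrable g (Measure.pi D)) (i : N) :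
    ∫ t, g t ∂(Measure.pi D)
      = ∫ r, (∫ t, g (Function.update t i r) ∂(Measure.pi D)) ∂(D i) := by
  have h := measurePreserving_update D i
  conv_lhs => rw [← h.map_eq]
  rw [integral_map h.measurable.aemeasurable (by rw [h.map_eq]; exact hg.aestronglyMeasurable),
    integral_prod _ (integrable_comp_update hg i)]

lemma integral_eval {i : N} {g : X i → ℝ} (hg : AEStronglyMeasurable g (D i)) :
    ∫ t, g (t i) ∂(Measure.pi D) = ∫ s, g s ∂(D i) := by
  have h := measurePreserving_eval D i
  conv_rhs => rw [← h.map_eq]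
  rw [integral_map h.measurable.aemeasurable (by rwa [h.map_eq])]

end Resample

/-! ### Regular priors -/

/-- The law of the value of bidder `i`. -/
def valueLaw {N : Type*} (D : N → Measure (N → ℝ)) (i : N) : Measure ℝ := (D i).map fun s => s i

section Auction

variable {E : Market N} {D : N → Measure (N → ℝ)} {f : N → ℝ → ℝ}

/-- A bound for all possible values and externalities. -/
def Market.typeBound (E : Market N) : ℝ := ∑ i, ∑ j, |E.hi i j|

lemma Market.hi_le_typeBound (E : Market N) (i j : N) : E.hi i j ≤ E.typeBound := by
  have h1 := Finset.single_le_sum (f := fun i => ∑ j, |E.hi i j|)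
    (fun i _ => Finset.sum_nonneg fun j _ => abs_nonneg (E.hi i j)) (Finset.mem_univ i)
  have h2 := Finset.single_le_sum (f := fun j => |E.hi i j|) (fun j _ => abs_nonneg (E.hi i j))
    (Finset.mem_univ j)
  exact (le_abs_self _).trans (h2.trans h1)

lemma Market.mem_Icc_of_mem_typeSpace (E : Market N) {i : N} {s : N → ℝ}
    (hs : s ∈ E.typeSpace i) (j : N) : s j ∈ Set.Icc 0 E.typeBound :=
  ⟨(E.lo_nonneg i j).trans (hs.1 j), (hs.2 j).trans (E.hi_le_typeBound i j)⟩

section Prior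

variable (hD : IsRegularPrior E D f)
include hD

lemma IsRegularPrior.isProbabilityMeasure_valueLaw (i : N) :
    IsProbabilityMeasure (valueLaw D i) := by
  have := hD.isProb i
  exact Measure.isProbabilityMeasure_map (measurable_pi_apply i).aemeasurable

lemma IsRegularPrior.hasDensityOn (i : N) :
    HasDensityOn (valueLaw D i) (f i) (E.lo i i) (E.hi i i) :=
  ⟨E.val_lt i, hD.measurable_density i, hD.density_nonneg i, hD.law_value i⟩

lemma IsRegularPrior.monotoneOn_virtualDensity (i : N) :
    MonotoneOn (virtualDensity (valueLaw D i) (f i) (E.totalExt i))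
      (Set.Icc (E.lo i i) (E.hi i i)) := by
  convert hD.regular i using 2 with v
  rw [virtualDensity, valueLaw, map_measureReal_apply (measurable_pi_apply i) measurableSet_Iic]
  rfl

lemma IsRegularPrior.ae_pi_mem : ∀ᵐ t ∂(Measure.pi D), ∀ i, t i ∈ E.typeSpace i := by
  have := hD.isProb
  exact ae_all_iff.2 fun i =>
    (measurePreserving_eval D i).quasiMeasurePreserving.ae (hD.mem_typeSpace i)

lemma IsRegularPrior.integral_value (i : N) {g : ℝ → ℝ} (hg : Measurable g) :
    ∫ s, g (s i) ∂(D i) = ∫ v, g v ∂(valueLaw D i) := by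
  rw [valueLaw, integral_map (measurable_pi_apply i).aemeasurable hg.aestronglyMeasurable]

/-- The one place where independence of a bidder's value and her exerted externalities enters. -/
lemma IsRegularPrior.integral_ext_mul {i j : N} (hij : j ≠ i) {g : ℝ → ℝ} (hg : Measurable g) :
    ∫ s, s j * g (s i) ∂(D i) = E.meanExt j i * ∫ v, g v ∂(valueLaw D i) := by
  have h1 : IndepFun (fun s : N → ℝ => s j) (fun s => g (s i)) (D i) :=
    ((hD.indep i).comp hg (measurable_pi_apply (⟨j, hij⟩ : {j : N // j ≠ i}))).symm
  rw [h1.integral_fun_mul_eq_mul_integral (measurable_pi_apply j).aestronglyMeasurable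
    (hg.comp (measurable_pi_apply i)).aestronglyMeasurable, hD.mean_eq j i hij,
    hD.integral_value i hg]

lemma IsRegularPrior.meanExt_nonneg {i j : N} (hij : i ≠ j) : 0 ≤ E.meanExt i j := by
  rw [← hD.mean_eq i j hij]
  refine integral_nonneg_of_ae ?_
  filter_upwards [hD.mem_typeSpace j] with s hs
  exact (E.mem_Icc_of_mem_typeSpace hs i).1

lemma IsRegularPrior.integral_pi_ext {i j : N} (hij : i ≠ j) :
    ∫ t, t j i ∂(Measure.pi D) = E.meanExt i j := by
  have := hD.isProb
  rw [integral_eval (D := D) (i := j) (g := fun s => s i)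
    (measurable_pi_apply i).aestronglyMeasurable, hD.mean_eq i j hij]

/-- Products of a type component and an allocation are integrable. -/
lemma IsRegularPrior.integrable_type_mul {i j : N} {g : (N → N → ℝ) → ℝ} (hg : Measurable g)
    (hg01 : ∀ t, g t ∈ Set.Icc (0 : ℝ) 1) :
    Integrable (fun t => t j i * g t) (Measure.pi D) := by
  have := hD.isProb
  refine integrable_of_measurable_of_ae_bound (by fun_prop) E.typeBound ?_
  filter_upwards [hD.ae_pi_mem] with t ht
  have h1 := E.mem_Icc_of_mem_typeSpace (ht j) i
  have h2 := hg01 t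
  rw [abs_of_nonneg (mul_nonneg h1.1 h2.1)]
  exact (mul_le_of_le_one_right h1.1 h2.2).trans h1.2

end Prior

/-! ### The revenue of feasible mechanisms -/

lemma update_allIn (t : N → N → ℝ) (i : N) (r : N → ℝ) :
    Function.update (allIn t) i (some r) = allIn (Function.update t i r) := by
  ext j : 1
  by_cases hj : j = i
  · subst hj; simp [allIn]
  · simp [allIn, hj]

/-- Interim expected allocation of bidder `i` who reports `r`. -/
def interimAlloc (D : N → Measure (N → ℝ)) (M : Mechanism N) (i : N) (r : N → ℝ) : ℝ :=
  ∫ t, M.alloc (allIn (Function.update t i r)) i ∂(Measure.pi D)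

/-- Interim expected payment plus externality cost of bidder `i` who reports `r`. -/
def interimCost (D : N → Measure (N → ℝ)) (M : Mechanism N) (i : N) (r : N → ℝ) : ℝ :=
  ∫ t, ((∑ j ∈ Finset.univ.erase i, t j i * M.alloc (allIn (Function.update t i r)) j)
    + M.pay (allIn (Function.update t i r)) i) ∂(Measure.pi D)

/-- The true type enters only through `s i`; this makes the screening problem one-dimensional. -/
lemma utility_update (i : N) (x p : N → ℝ) (t : N → N → ℝ) (s : N → ℝ) :
    utility i x p (Function.update t i s)
      = s i * x i - (∑ j ∈ Finset.univ.erase i, t j i * x j) - p i := by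
  unfold utility
  rw [Function.update_self]
  congr 2
  refine Finset.sum_congr rfl fun j hj => ?_
  rw [Function.update_of_ne (Finset.ne_of_mem_erase hj)]

/-! ### Incentives, rents and payments in a feasible mechanism -/

section Feasible

variable {M : Mechanism N}

lemma Mechanism.IsValid.measurable_alloc_apply (hM : M.IsValid) (i : N) :
    Measurable fun t => M.alloc (allIn t) i :=
  (measurable_pi_apply i).comp hM.measurable_alloc

lemma Mechanism.IsValid.measurable_pay_apply (hM : M.IsValid) (i : N) :
    Measurable fun t => M.pay (allIn t) i :=
  (measurable_pi_apply i).comp hM.measurable_pay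

lemma measurable_update_const (i : N) (r : N → ℝ) :
    Measurable fun t : N → N → ℝ => Function.update t i r :=
  measurable_update'.comp (measurable_id.prodMk measurable_const)

lemma Mechanism.IsValid.integrable_alloc [∀ i, IsProbabilityMeasure (D i)] (hM : M.IsValid)
    (i j : N) (r : N → ℝ) :
    Integrable (fun t => M.alloc (allIn (Function.update t i r)) j) (Measure.pi D) :=
  integrable_of_measurable_of_ae_bound
    ((hM.measurable_alloc_apply j).comp (measurable_update_const i r)) 1
    (.of_forall fun t => by
      have := hM.alloc_mem (allIn (Function.update t i r)) j
      rw [abs_of_nonneg this.1]; exact this.2)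

lemma IsRegularPrior.integrable_externality (hD : IsRegularPrior E D f) (hM : M.IsValid)
    (i : N) (r : N → ℝ) :
    Integrable (fun t => ∑ j ∈ Finset.univ.erase i,
      t j i * M.alloc (allIn (Function.update t i r)) j) (Measure.pi D) :=
  integrable_finsetSum _ fun j _ => hD.integrable_type_mul
    ((hM.measurable_alloc_apply j).comp (measurable_update_const i r))
    fun _ => hM.alloc_mem _ _

variable (hD : IsRegularPrior E D f) (hM : IsFeasible E D M)
include hD hM

lemma interimUtility_some {i : N} {r : N → ℝ} (hr : r ∈ E.typeSpace i) (s : N → ℝ) :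
    interimUtility D M i (some r) s = s i * interimAlloc D M i r - interimCost D M i r := by
  have := hD.isProb
  have hpay := hM.integrable_pay i r hr
  simp only [update_allIn] at hpay
  have hcost : Integrable (fun t => (∑ j ∈ Finset.univ.erase i,
      t j i * M.alloc (allIn (Function.update t i r)) j)
      + M.pay (allIn (Function.update t i r)) i) (Measure.pi D) :=
    (hD.integrable_externality hM.valid i r).add hpay
  unfold interimUtility interimAlloc interimCost
  rw [← integral_const_mul, ← integral_sub ((hM.valid.integrable_alloc i i r).const_mul _) hcost]
  refine integral_congr_ae (.of_forall fun t => ?_)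
  simp only [update_allIn, utility_update]
  ring

/-- A bidder who stays out loses at most the mean externalities that she suffers. -/
lemma neg_sum_meanExt_le_interimUtility_none (i : N) (s : N → ℝ) :
    -∑ j ∈ Finset.univ.erase i, E.meanExt i j ≤ interimUtility D M i none s := by
  have := hD.isProb
  have e : -∑ j ∈ Finset.univ.erase i, E.meanExt i j
      = ∫ t, -∑ j ∈ Finset.univ.erase i, t j i * 1 ∂(Measure.pi D) := by
    rw [integral_neg, integral_finsetSum]
    · congr 1
      refine Finset.sum_congr rfl fun j hj => ?_
      simp [hD.integral_pi_ext (Finset.ne_of_mem_erase hj).symm]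
    · exact fun j _ => hD.integrable_type_mul measurable_const (by simp)
  have hmeas : ∀ j, Measurable fun t => M.alloc (Function.update (allIn t) i none) j := fun j =>
    (measurable_pi_apply j).comp (hM.valid.measurable_alloc_out i)
  have hout : ∀ t : N → N → ℝ, M.alloc (Function.update (allIn t) i none) i = 0 ∧
      M.pay (Function.update (allIn t) i none) i = 0 := fun t =>
    hM.valid.out _ _ (by simp)
  rw [e, interimUtility]
  refine integral_mono_ae ?_ ?_ ?_
  · exact (integrable_finsetSum _ fun j _ =>
      hD.integrable_type_mul measurable_const (by simp)).neg
  · simp only [utility_update, hout]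
    simp only [mul_zero, sub_zero, zero_sub]
    exact (integrable_finsetSum _ fun j _ =>
      hD.integrable_type_mul (hmeas j) fun _ => hM.valid.alloc_mem _ _).neg
  -- The worst case for an abstaining bidder, who pays nothing, is that all the others get the good.
  · filter_upwards [hD.ae_pi_mem] with t ht
    simp only [utility_update, hout, mul_zero, sub_zero, zero_sub]
    gcongr with j _
    · exact (E.mem_Icc_of_mem_typeSpace (ht j) i).1
    · exact (hM.valid.alloc_mem _ _).2

/-- For a fixed report `r`, utility is affine in the true value with slope the interim allocation at
`r`; that `s` does not gain from this report is the subgradient inequality. -/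
lemma incentive_inequality {i : N} {s r : N → ℝ} (hs : s ∈ E.typeSpace i)
    (hr : r ∈ E.typeSpace i) :
    (s i - r i) * interimAlloc D M i r
      ≤ interimUtility D M i (some s) s - interimUtility D M i (some r) r := by
  have h := hM.bnic i s hs r hr
  have h1 := interimUtility_some hD hM hr s
  have h2 := interimUtility_some hD hM hr r
  linarith

/-- The payments of a feasible mechanism are integrable. -/
lemma integrable_pay (i : N) : Integrable (fun t => M.pay (allIn t) i) (Measure.pi D) := by
  have := hD.isProb
  have hmp := measurePreserving_update D i
  have hmeas := hM.valid.measurable_pay_apply i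
  rw [← hmp.integrable_comp hmeas.aestronglyMeasurable]
  have hm : Measurable ((fun t => M.pay (allIn t) i) ∘
      fun q : (N → ℝ) × (N → N → ℝ) => Function.update q.2 i q.1) := hmeas.comp hmp.measurable
  rw [integrable_prod_iff hm.aestronglyMeasurable]
  constructor
  · filter_upwards [hD.mem_typeSpace i] with r hr
    simpa only [update_allIn, Function.comp_apply] using hM.integrable_pay i r hr
  -- Feasibility only makes each interim payment finite. Individual rationality bounds them
  -- uniformly: value gained minus payment cannot fall below the outside option.
  · refine .of_bound (hm.norm.stronglyMeasurable.integral_prod_right').aestronglyMeasurable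
      (E.typeBound + ∑ j ∈ Finset.univ.erase i, E.meanExt i j) ?_
    filter_upwards [hD.mem_typeSpace i] with r hr
    have hpay := hM.integrable_pay i r hr
    simp only [update_allIn] at hpay
    have h0 : ∀ t, 0 ≤ M.pay (allIn (Function.update t i r)) i := fun t => hM.valid.pay_nonneg _ _
    simp only [Function.comp_apply, Real.norm_of_nonneg (h0 _)]
    rw [Real.norm_of_nonneg (integral_nonneg h0)]
    have h1 := (neg_sum_meanExt_le_interimUtility_none hD hM i r).trans (hM.ir i r hr)
    rw [interimUtility_some hD hM hr, interimCost,
      integral_add (hD.integrable_externality hM.valid i r) hpay] at h1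
    have h2 : 0 ≤ ∫ t, (∑ j ∈ Finset.univ.erase i,
        t j i * M.alloc (allIn (Function.update t i r)) j) ∂(Measure.pi D) := by
      refine integral_nonneg_of_ae ?_
      filter_upwards [hD.ae_pi_mem] with t ht
      exact Finset.sum_nonneg fun j _ => mul_nonneg (E.mem_Icc_of_mem_typeSpace (ht j) i).1
        (hM.valid.alloc_mem _ _).1
    have h3 : r i * interimAlloc D M i r ≤ E.typeBound := by
      have hri := E.mem_Icc_of_mem_typeSpace hr i
      have : interimAlloc D M i r ≤ 1 := by
        have := integral_mono (hM.valid.integrable_alloc (D := D) i i r) (integrable_const 1)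
          fun t => (hM.valid.alloc_mem _ _).2
        simpa [interimAlloc] using this
      exact (mul_le_of_le_one_right hri.1 this).trans hri.2
    linarith

/-- The allocation rule, as a function of her value, that determines the rent of bidder `i`. -/
def valueRule (E : Market N) (D : N → Measure (N → ℝ)) (M : Mechanism N) (i : N) (v : ℝ) : ℝ :=
  interimAlloc D M i (E.leastType i v)

omit hD hM in
lemma valueRule_mem [∀ i, IsProbabilityMeasure (D i)] (hM : M.IsValid) (i : N) (v : ℝ) :
    valueRule E D M i v ∈ Set.Icc (0 : ℝ) 1 := by
  constructor
  · exact integral_nonneg fun t => (hM.alloc_mem _ _).1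
  · have := integral_mono (hM.integrable_alloc (D := D) i i (E.leastType i v))
      (integrable_const 1) fun t => (hM.alloc_mem _ _).2
    simpa [valueRule, interimAlloc] using this

omit hM in
lemma IsRegularPrior.typeSpace_nonempty (i : N) : (E.typeSpace i).Nonempty := by
  have := hD.isProb i
  exact (hD.mem_typeSpace i).exists

lemma monotone_valueRule (i : N) : Monotone (valueRule E D M i) :=
  monotone_rule_leastType (W := fun s => interimUtility D M i (some s) s)
    (fun _ hs _ hr => incentive_inequality hD hM hs hr) (hD.typeSpace_nonempty i)

/-- A monotone rule has countably many jumps, and the value law has no atoms. -/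
lemma interimAlloc_ae_eq (i : N) :
    ∀ᵐ s ∂(D i), interimAlloc D M i s = valueRule E D M i (s i) := by
  have := hD.isProb i
  have hns := (hD.hasDensityOn i).nullSingletonClass
  have hcount : (valueLaw D i) ({v | ¬ ContinuousAt (valueRule E D M i) v} ∪
      {E.lo i i, E.hi i i}) = 0 :=
    ((monotone_valueRule hD hM i).countable_not_continuousAt.union
      (Set.toFinite _).countable).measure_zero _
  have hae : ∀ᵐ s ∂(D i), s i ∉ ({v | ¬ ContinuousAt (valueRule E D M i) v} ∪
      {E.lo i i, E.hi i i} : Set ℝ) :=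
    ae_of_ae_map (μ := D i) (f := fun s => s i) (measurable_pi_apply i).aemeasurable
      (measure_eq_zero_iff_ae_notMem.1 hcount)
  filter_upwards [hae, hD.mem_typeSpace i] with s hs hsT
  simp only [Set.mem_union, Set.mem_ofPred_eq, Set.mem_insert_iff, Set.mem_singleton_iff,
    not_or, not_not] at hs
  exact rule_eq_of_continuousAt (W := fun s => interimUtility D M i (some s) s)
    (fun _ hs _ hr => incentive_inequality hD hM hs hr) hsT
    ⟨lt_of_le_of_ne (hsT.1 i) (Ne.symm hs.2.1), lt_of_le_of_ne (hsT.2 i) hs.2.2⟩ hs.1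

/-- With the allocation a function of the value, the factor `s j` for `j ≠ i` can be averaged out by
`integral_ext_mul`. -/
lemma integral_type_mul_alloc (i j : N) :
    ∫ t, t i j * M.alloc (allIn t) i ∂(Measure.pi D)
      = ∫ s, s j * valueRule E D M i (s i) ∂(D i) := by
  have := hD.isProb
  rw [integral_eq_integral_update (hD.integrable_type_mul (hM.valid.measurable_alloc_apply i)
    fun _ => hM.valid.alloc_mem _ _) i]
  refine integral_congr_ae ?_
  filter_upwards [interimAlloc_ae_eq hD hM i] with s hs
  simp only [Function.update_self]
  rw [integral_const_mul, ← hs, interimAlloc]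

/-- Payment is surplus minus rent. Measurability of the rent is not assumed; Fubini provides it with
the integrability. -/
lemma integral_pay_eq (i : N) :
    Integrable (fun s => interimUtility D M i (some s) s) (D i) ∧
    ∫ t, M.pay (allIn t) i ∂(Measure.pi D)
      = ∫ t, t i i * M.alloc (allIn t) i ∂(Measure.pi D)
        - ∑ j ∈ Finset.univ.erase i, ∫ t, t j i * M.alloc (allIn t) j ∂(Measure.pi D)
        - ∫ s, interimUtility D M i (some s) s ∂(D i) := by
  have := hD.isProb
  have hi : ∀ j k, Integrable (fun t => t j k * M.alloc (allIn t) j) (Measure.pi D) := fun j k =>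
    hD.integrable_type_mul (hM.valid.measurable_alloc_apply j) fun _ => hM.valid.alloc_mem _ _
  have hs : Integrable (fun t => ∑ j ∈ Finset.univ.erase i, t j i * M.alloc (allIn t) j)
      (Measure.pi D) := integrable_finsetSum _ fun j _ => hi j i
  have hp := integrable_pay hD hM i
  have hd : Integrable (fun t => t i i * M.alloc (allIn t) i
      - ∑ j ∈ Finset.univ.erase i, t j i * M.alloc (allIn t) j) (Measure.pi D) := (hi i i).sub hs
  have hu : Integrable (fun t => utility i (M.alloc (allIn t)) (M.pay (allIn t)) t)
      (Measure.pi D) := hd.sub hp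
  have e := integral_eq_integral_update hu i
  have e' : ∀ s, ∫ t, utility i (M.alloc (allIn (Function.update t i s)))
      (M.pay (allIn (Function.update t i s))) (Function.update t i s) ∂(Measure.pi D)
      = interimUtility D M i (some s) s := by
    intro s; simp only [interimUtility, update_allIn]
  simp only [e'] at e
  constructor
  · have := (integrable_comp_update hu i).integral_prod_left
    simpa only [e'] using this
  · rw [← e]
    simp only [utility]
    rw [integral_sub hd hp, integral_sub (hi i i) hs,
      integral_finsetSum _ fun j _ => hi j i]
    ring

/-- Envelope bound for the interim utility. -/
lemma integral_interimUtility_ge (i : N) :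
    ∫ v, (∫ w in E.lo i i..v, valueRule E D M i w) ∂(valueLaw D i)
      - ∑ j ∈ Finset.univ.erase i, E.meanExt i j
      ≤ ∫ s, interimUtility D M i (some s) s ∂(D i) := by
  have := hD.isProb i
  have := hD.isProb
  have hmono := monotone_valueRule hD hM i
  have hpm : Monotone fun v => ∫ w in E.lo i i..v, valueRule E D M i w := by
    intro v w hvw
    have := intervalIntegral.integral_nonneg (μ := volume) hvw fun u _ =>
      (valueRule_mem (E := E) (D := D) hM.valid i u).1
    have h2 := intervalIntegral.integral_add_adjacent_intervals
      (hmono.intervalIntegrable (μ := volume) (a := E.lo i i) (b := v))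
      (hmono.intervalIntegrable (μ := volume) (a := v) (b := w))
    simp only
    linarith
  rw [← hD.integral_value i hpm.measurable]
  have hmeas : Measurable fun s : N → ℝ => ∫ w in E.lo i i..s i, valueRule E D M i w :=
    hpm.measurable.comp (measurable_pi_apply i)
  have hint : Integrable (fun s : N → ℝ => ∫ w in E.lo i i..s i, valueRule E D M i w) (D i) := by
    refine integrable_of_measurable_of_ae_bound hmeas
      (∫ w in E.lo i i..E.hi i i, valueRule E D M i w) ?_
    filter_upwards [hD.mem_typeSpace i] with s hs
    rw [abs_of_nonneg]
    · exact hpm (hs.2 i)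
    · exact intervalIntegral.integral_nonneg (hs.1 i) fun u _ => (valueRule_mem hM.valid i u).1
  have e : ∫ s, (∫ w in E.lo i i..s i, valueRule E D M i w) ∂(D i)
      - ∑ j ∈ Finset.univ.erase i, E.meanExt i j
      = ∫ s, ((∫ w in E.lo i i..s i, valueRule E D M i w)
        - ∑ j ∈ Finset.univ.erase i, E.meanExt i j) ∂(D i) := by
    rw [integral_sub hint (integrable_const _)]
    simp
  rw [e]
  refine integral_mono_ae (hint.sub (integrable_const _)) (integral_pay_eq hD hM i).1 ?_
  filter_upwards [hD.mem_typeSpace i] with s hs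
  have h1 := rent_add_integral_le (W := fun s => interimUtility D M i (some s) s)
    (fun _ hs _ hr => incentive_inequality hD hM hs hr) hs
  have hmem := leastType_mem ⟨s, hs⟩ (E.lo i i)
  -- Individual rationality at the least type fixes the constant in the envelope bound.
  have h2 := (neg_sum_meanExt_le_interimUtility_none hD hM i (E.leastType i (E.lo i i))).trans
    (hM.ir i _ hmem)
  simp only [valueRule]
  linarith

omit hD hM in
lemma sum_sum_erase_comm (g : N → N → ℝ) :
    ∑ i, ∑ j ∈ Finset.univ.erase i, g i j = ∑ i, ∑ j ∈ Finset.univ.erase i, g j i :=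
  Finset.sum_comm' fun i j => by simp [ne_comm]

/-- Feasible mechanisms do not earn more than the best posted prices. -/
lemma revenue_le_of_isFeasible {θ : N → ℝ}
    (hθ : ∀ i, ∀ x : ℝ → ℝ, Measurable x → (∀ v, x v ∈ Set.Icc (0 : ℝ) 1) →
      ∫ v, (v - E.totalExt i) * x v ∂(valueLaw D i)
        - ∫ v, (∫ w in E.lo i i..v, x w) ∂(valueLaw D i)
        ≤ netRevenue (valueLaw D i) (E.totalExt i) (θ i)) :
    revenue D M ≤ ∑ i, (netRevenue (valueLaw D i) (E.totalExt i) (θ i) + E.totalExt i) := by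
  have := hD.isProb
  have hmono := fun i => monotone_valueRule hD hM i
  have hmeas := fun i => (hmono i).measurable
  rw [revenue, integral_finsetSum _ fun i _ => integrable_pay hD hM i]
  simp only [(integral_pay_eq hD hM _).2]
  -- Externalities are regrouped from the bidder who suffers them to the one who exerts them, so
  -- that the `i`-th surplus involves only the allocation of `i`.
  rw [Finset.sum_sub_distrib, Finset.sum_sub_distrib, sum_sum_erase_comm,
    ← Finset.sum_sub_distrib, ← Finset.sum_sub_distrib, Finset.sum_add_distrib]
  simp only [Market.totalExt]
  -- The constants go the other way: the sum of the `totalExt` becomes the suffered externalities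
  -- that appear in the outside options.
  rw [← sum_sum_erase_comm E.meanExt, ← Finset.sum_add_distrib]
  refine Finset.sum_le_sum fun i _ => ?_
  have := hD.isProbabilityMeasure_valueLaw i
  have h1 := hθ i _ (hmeas i) fun v => valueRule_mem (E := E) (D := D) hM.valid i v
  have h2 := integral_interimUtility_ge hD hM i
  have h3 : ∫ t, t i i * M.alloc (allIn t) i ∂(Measure.pi D)
      = ∫ v, v * valueRule E D M i v ∂(valueLaw D i) := by
    rw [integral_type_mul_alloc hD hM, hD.integral_value i (g := fun v => v * valueRule E D M i v)
      (measurable_id.mul (hmeas i))]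
  have h4 : ∑ j ∈ Finset.univ.erase i, ∫ t, t i j * M.alloc (allIn t) i ∂(Measure.pi D)
      = E.totalExt i * ∫ v, valueRule E D M i v ∂(valueLaw D i) := by
    rw [Market.totalExt, Finset.sum_mul]
    refine Finset.sum_congr rfl fun j hj => ?_
    rw [integral_type_mul_alloc hD hM, hD.integral_ext_mul (Finset.ne_of_mem_erase hj) (hmeas i)]
  have hb : ∀ v, |valueRule E D M i v| ≤ 1 := fun v => by
    have := valueRule_mem (E := E) (D := D) hM.valid i v
    rw [abs_of_nonneg this.1]; exact this.2
  have hi1 : Integrable (valueRule E D M i) (valueLaw D i) :=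
    integrable_of_measurable_of_ae_bound (hmeas i) 1 (.of_forall hb)
  have hi2 : Integrable (fun v => v * valueRule E D M i v) (valueLaw D i) := by
    refine integrable_of_measurable_of_ae_bound (measurable_id.mul (hmeas i)) (E.hi i i) ?_
    filter_upwards [(hD.hasDensityOn i).ae_mem] with v hv
    have hv0 := (E.lo_nonneg i i).trans hv.1
    rw [abs_mul, abs_of_nonneg hv0]
    exact (mul_le_of_le_one_right hv0 (hb v)).trans hv.2
  have h5 : ∫ v, (v - E.totalExt i) * valueRule E D M i v ∂(valueLaw D i)
      = ∫ v, v * valueRule E D M i v ∂(valueLaw D i)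
        - E.totalExt i * ∫ v, valueRule E D M i v ∂(valueLaw D i) := by
    rw [← integral_const_mul, ← integral_sub hi2 (hi1.const_mul _)]
    refine integral_congr_ae (.of_forall fun v => ?_)
    simp only; ring
  rw [h3, h4]
  simp only [Market.totalExt] at *
  linarith

end Feasible

/-! ### Posted-threshold mechanisms -/

lemma decision_mem (p v : ℝ) : decision p v ∈ Set.Icc (0 : ℝ) 1 := by
  unfold decision; split_ifs <;> simp

lemma measurable_decision : Measurable fun q : ℝ × ℝ => decision q.1 q.2 :=
  Measurable.ite (measurableSet_le measurable_fst measurable_snd) measurable_const measurable_const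

lemma measurable_decision_right (p : ℝ) : Measurable (decision p) :=
  measurable_decision.comp (measurable_const.prodMk measurable_id)

lemma integral_decision (ν : Measure ℝ) (p : ℝ) :
    ∫ v, decision p v ∂ν = ν.real (Set.Ici p) := by
  have : decision p = (Set.Ici p).indicator fun _ => 1 := by
    ext v; simp [decision, Set.indicator_apply]
  rw [this, integral_indicator_const _ measurableSet_Ici]
  simp

lemma postedAlloc_allIn (τ : N → ℝ) (t : N → N → ℝ) (i : N) :
    postedAlloc τ (allIn t) i = decision (τ i) (t i i) := by
  simp [postedAlloc, allIn, decision]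

lemma postedAlloc_out (τ : N → ℝ) (t : N → N → ℝ) (i j : N) :
    postedAlloc τ (Function.update (allIn t) i none) j = if j = i then 0 else 1 := by
  by_cases hj : j = i
  · subst hj; simp [postedAlloc]
  · have h : ∃ k, Function.update (allIn t) i none k = none := ⟨i, by simp⟩
    simp [postedAlloc, hj, h, allIn]

lemma postedAlloc_mem (τ : N → ℝ) (b : Bids N) (i : N) :
    postedAlloc τ b i ∈ Set.Icc (0 : ℝ) 1 := by
  unfold postedAlloc
  split
  · simp
  · split_ifs <;> simp

lemma pay_postedMechanism_allIn (E : Market N) (τ : N → ℝ) (t : N → N → ℝ) (i : N) :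
    (postedMechanism E τ).pay (allIn t) i = τ i * decision (τ i) (t i i)
      + ∑ j ∈ Finset.univ.erase i, E.meanExt i j * (1 - decision (τ j) (t j j)) := by
  simp only [← postedAlloc_allIn]
  rfl

lemma pay_postedMechanism_out (E : Market N) (τ : N → ℝ) (t : N → N → ℝ) (i j : N) :
    (postedMechanism E τ).pay (Function.update (allIn t) i none) j
      = if j = i then 0 else τ j + E.meanExt j i := by
  by_cases hj : j = i
  · subst hj; simp [postedMechanism]
  · have h' : Function.update (allIn t) i none j = some (t j) := by
      rw [Function.update_of_ne hj]; rfl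
    have e : (postedMechanism E τ).pay (Function.update (allIn t) i none) j
        = τ j * postedAlloc τ (Function.update (allIn t) i none) j
          + ∑ k ∈ Finset.univ.erase j, E.meanExt j k
            * (1 - postedAlloc τ (Function.update (allIn t) i none) k) := by
      simp [postedMechanism, h']
    rw [e]
    simp only [postedAlloc_out, hj, if_false, mul_one, add_right_inj]
    rw [Finset.sum_eq_single i]
    · simp
    · intro k _ hk; simp [hk]
    · intro h; simp [Ne.symm hj] at h

lemma measurable_decision_eval (τ : N → ℝ) (i : N) :
    Measurable fun t : N → N → ℝ => decision (τ i) (t i i) :=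
  (measurable_decision_right (τ i)).comp ((measurable_pi_apply i).comp (measurable_pi_apply i))

/-! ### Feasibility and revenue of posted thresholds -/

section

variable (hD : IsRegularPrior E D f)
include hD

lemma IsRegularPrior.integrable_decision (τ : N → ℝ) (i : N) :
    Integrable (fun t : N → N → ℝ => decision (τ i) (t i i)) (Measure.pi D) := by
  have := hD.isProb
  refine integrable_of_measurable_of_ae_bound (measurable_decision_eval τ i) 1
    (.of_forall fun t => ?_)
  rw [abs_of_nonneg (decision_mem _ _).1]
  exact (decision_mem _ _).2

lemma IsRegularPrior.integral_pi_decision (p : ℝ) (i : N) :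
    ∫ t, decision p (t i i) ∂(Measure.pi D) = (valueLaw D i).real (Set.Ici p) := by
  have := hD.isProb
  rw [integral_eval (D := D) (i := i) (g := fun s => decision p (s i))
    ((measurable_decision_right p).comp (measurable_pi_apply i)).aestronglyMeasurable,
    hD.integral_value i (measurable_decision_right p), integral_decision]

lemma IsRegularPrior.integral_pi_ext_mul_decision (p : ℝ) {i j : N} (hij : j ≠ i) :
    ∫ t, t j i * decision p (t j j) ∂(Measure.pi D)
      = E.meanExt i j * (valueLaw D j).real (Set.Ici p) := by
  have := hD.isProb
  rw [integral_eval (D := D) (i := j) (g := fun s => s i * decision p (s j))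
    ((measurable_pi_apply i).mul ((measurable_decision_right p).comp
      (measurable_pi_apply j))).aestronglyMeasurable,
    hD.integral_ext_mul hij.symm (measurable_decision_right p), integral_decision]

lemma IsRegularPrior.isValid_postedMechanism {τ : N → ℝ} (hτ : ∀ i, 0 ≤ τ i) :
    (postedMechanism E τ).IsValid where
  alloc_mem b i := postedAlloc_mem τ b i
  pay_nonneg b i := by
    simp only [postedMechanism]
    split
    · rfl
    · refine add_nonneg (mul_nonneg (hτ i) (postedAlloc_mem τ b i).1)
        (Finset.sum_nonneg fun j hj => mul_nonneg
          (hD.meanExt_nonneg (Finset.ne_of_mem_erase hj).symm)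
          (sub_nonneg.2 (postedAlloc_mem τ b j).2))
  out b i hb := by simp [postedMechanism, postedAlloc, hb]
  measurable_alloc := measurable_pi_iff.2 fun i => by
    simpa only [postedMechanism, postedAlloc_allIn] using measurable_decision_eval τ i
  measurable_pay := measurable_pi_iff.2 fun i => by
    simp only [pay_postedMechanism_allIn]
    exact ((measurable_decision_eval τ i).const_mul _).add (Finset.measurable_fun_sum _ fun j _ =>
      ((measurable_decision_eval τ j).const_sub 1).const_mul _)
  measurable_alloc_out i := measurable_pi_iff.2 fun j => by
    simp only [postedMechanism, postedAlloc_out, measurable_const]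
  measurable_pay_out i := measurable_pi_iff.2 fun j => by
    simp only [pay_postedMechanism_out, measurable_const]

/-- The charge `m (1 - X_j)` complements the mean loss `m X_j` to the constant `m`, so the decisions
of the others drop out. -/
lemma IsRegularPrior.interimUtility_postedMechanism_some (τ : N → ℝ) (i : N) (r s : N → ℝ) :
    interimUtility D (postedMechanism E τ) i (some r) s
      = (s i - τ i) * decision (τ i) (r i) - ∑ j ∈ Finset.univ.erase i, E.meanExt i j := by
  have := hD.isProb
  have e : ∀ t : N → N → ℝ, utility i
      ((postedMechanism E τ).alloc (Function.update (allIn t) i (some r)))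
      ((postedMechanism E τ).pay (Function.update (allIn t) i (some r))) (Function.update t i s)
      = (s i - τ i) * decision (τ i) (r i) - ∑ j ∈ Finset.univ.erase i,
        (t j i * decision (τ j) (t j j) + E.meanExt i j * (1 - decision (τ j) (t j j))) := by
    intro t
    rw [utility_update, update_allIn, pay_postedMechanism_allIn]
    simp only [postedMechanism, postedAlloc_allIn, Function.update_self]
    have h1 : ∀ g : N → ℝ → ℝ, ∑ j ∈ Finset.univ.erase i,
        g j (decision (τ j) (Function.update t i r j j))
        = ∑ j ∈ Finset.univ.erase i, g j (decision (τ j) (t j j)) := fun g =>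
      Finset.sum_congr rfl fun j hj => by
        rw [Function.update_of_ne (Finset.ne_of_mem_erase hj)]
    rw [Finset.sum_add_distrib, h1 fun j y => t j i * y, h1 fun j y => E.meanExt i j * (1 - y)]
    ring
  have hi : ∀ j ∈ Finset.univ.erase i, Integrable (fun t : N → N → ℝ =>
      t j i * decision (τ j) (t j j) + E.meanExt i j * (1 - decision (τ j) (t j j)))
      (Measure.pi D) := fun j _ =>
    (hD.integrable_type_mul (measurable_decision_eval τ j) fun _ => decision_mem _ _).add
      (((integrable_const 1).sub (hD.integrable_decision τ j)).const_mul _)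
  simp only [interimUtility, e]
  rw [integral_sub (integrable_const _) (integrable_finsetSum _ hi), integral_finsetSum _ hi]
  simp only [integral_const, probReal_univ, one_smul]
  congr 1
  refine Finset.sum_congr rfl fun j hj => ?_
  have hm : Integrable (fun t : N → N → ℝ => E.meanExt i j * (1 - decision (τ j) (t j j)))
      (Measure.pi D) := ((integrable_const 1).sub (hD.integrable_decision τ j)).const_mul _
  rw [integral_add (hD.integrable_type_mul (measurable_decision_eval τ j) fun _ => decision_mem _ _)
    hm, integral_const_mul,
    integral_sub (integrable_const 1) (hD.integrable_decision τ j),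
    hD.integral_pi_ext_mul_decision _ (Finset.ne_of_mem_erase hj), hD.integral_pi_decision]
  simp only [integral_const, probReal_univ, one_smul]
  ring

/-- Serving everybody else is the harshest reaction to abstention: the lower bound
`neg_sum_meanExt_le_interimUtility_none` is attained. -/
lemma IsRegularPrior.interimUtility_postedMechanism_none (τ : N → ℝ) (i : N) (s : N → ℝ) :
    interimUtility D (postedMechanism E τ) i none s
      = -∑ j ∈ Finset.univ.erase i, E.meanExt i j := by
  have := hD.isProb
  have e : ∀ t : N → N → ℝ, utility i
      ((postedMechanism E τ).alloc (Function.update (allIn t) i none))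
      ((postedMechanism E τ).pay (Function.update (allIn t) i none)) (Function.update t i s)
      = -∑ j ∈ Finset.univ.erase i, t j i * 1 := by
    intro t
    rw [utility_update, pay_postedMechanism_out]
    simp only [postedMechanism, postedAlloc_out, if_true, mul_zero, sub_zero, zero_sub]
    congr 1
    refine Finset.sum_congr rfl fun j hj => ?_
    rw [if_neg (Finset.ne_of_mem_erase hj)]
  simp only [interimUtility, e]
  rw [integral_neg, integral_finsetSum _ fun j _ =>
    hD.integrable_type_mul measurable_const (by simp)]
  congr 1
  refine Finset.sum_congr rfl fun j hj => ?_
  simp [hD.integral_pi_ext (Finset.ne_of_mem_erase hj).symm]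

lemma IsRegularPrior.integrable_pay_postedMechanism (τ : N → ℝ) (i : N) :
    Integrable (fun t => (postedMechanism E τ).pay (allIn t) i) (Measure.pi D) := by
  have := hD.isProb
  simp only [pay_postedMechanism_allIn]
  exact ((hD.integrable_decision τ i).const_mul _).add (integrable_finsetSum _ fun j _ =>
    ((integrable_const 1).sub (hD.integrable_decision τ j)).const_mul _)

lemma IsRegularPrior.isFeasible_postedMechanism {τ : N → ℝ} (hτ : ∀ i, 0 ≤ τ i) :
    IsFeasible E D (postedMechanism E τ) := by
  have := hD.isProb
  have hval := hD.isValid_postedMechanism hτ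
  -- Buying exactly when the value reaches the price is optimal.
  have hd : ∀ p v w : ℝ, (v - p) * decision p w ≤ (v - p) * decision p v := by
    intro p v w
    unfold decision
    split_ifs <;> simp <;> linarith
  refine ⟨hval, fun i r _ => ?_, fun i s _ r _ => ?_, fun i s _ => ?_⟩
  · simp only [update_allIn]
    refine integrable_of_measurable_of_ae_bound
      ((hval.measurable_pay_apply i).comp (measurable_update_const i r))
      (τ i + ∑ j ∈ Finset.univ.erase i, E.meanExt i j) (.of_forall fun t => ?_)
    rw [abs_of_nonneg (hval.pay_nonneg _ _), pay_postedMechanism_allIn]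
    refine add_le_add (mul_le_of_le_one_right (hτ i) (decision_mem _ _).2)
      (Finset.sum_le_sum fun j hj => ?_)
    exact mul_le_of_le_one_right (hD.meanExt_nonneg (Finset.ne_of_mem_erase hj).symm)
      (by linarith [(decision_mem (τ j) (Function.update t i r j j)).1])
  · rw [hD.interimUtility_postedMechanism_some, hD.interimUtility_postedMechanism_some]
    linarith [hd (τ i) (s i) (r i)]
  · rw [hD.interimUtility_postedMechanism_some, hD.interimUtility_postedMechanism_none]
    -- A fictitious value below the threshold means no purchase, so truthful buying has nonnegative
    -- surplus.
    have h1 := hd (τ i) (s i) (τ i - 1)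
    have h2 : decision (τ i) (τ i - 1) = 0 := by simp [decision]
    rw [h2, mul_zero] at h1
    linarith

/-- The charges collected because `j` is not served sum to `S_j (1 - X_j)`, and `τ q + S (1 - q) =
(τ - S) q + S`. -/
lemma IsRegularPrior.revenue_postedMechanism (τ : N → ℝ) :
    revenue D (postedMechanism E τ)
      = ∑ i, (netRevenue (valueLaw D i) (E.totalExt i) (τ i) + E.totalExt i) := by
  have := hD.isProb
  rw [revenue, integral_finsetSum _ fun i _ => hD.integrable_pay_postedMechanism τ i]
  have hi : ∀ i j, Integrable (fun t : N → N → ℝ => E.meanExt i j * (1 - decision (τ j) (t j j)))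
      (Measure.pi D) := fun i j =>
    ((integrable_const 1).sub (hD.integrable_decision τ j)).const_mul _
  have e : ∀ i, ∫ t, (postedMechanism E τ).pay (allIn t) i ∂(Measure.pi D)
      = τ i * (valueLaw D i).real (Set.Ici (τ i)) + ∑ j ∈ Finset.univ.erase i,
        E.meanExt i j * (1 - (valueLaw D j).real (Set.Ici (τ j))) := by
    intro i
    simp only [pay_postedMechanism_allIn]
    rw [integral_add ((hD.integrable_decision τ i).const_mul _)
      (integrable_finsetSum _ fun j _ => hi i j), integral_finsetSum _ fun j _ => hi i j,
      integral_const_mul, hD.integral_pi_decision]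
    congr 1
    refine Finset.sum_congr rfl fun j _ => ?_
    rw [integral_const_mul, integral_sub (integrable_const 1) (hD.integrable_decision τ j),
      hD.integral_pi_decision]
    simp
  simp only [e]
  rw [Finset.sum_add_distrib, sum_sum_erase_comm, ← Finset.sum_add_distrib]
  refine Finset.sum_congr rfl fun i _ => ?_
  rw [← Finset.sum_mul, netRevenue, Market.totalExt]
  ring

/-- The best posted thresholds form an optimal mechanism. -/
lemma IsRegularPrior.exists_optimal_thresholds :
    ∃ θ : N → ℝ, (∀ i, θ i ∈ Set.Icc (E.lo i i) (E.hi i i)) ∧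
      IsRevenueOptimal E D (postedMechanism E θ) := by
  have := hD.isProbabilityMeasure_valueLaw
  choose θ hθ hopt using fun i =>
    exists_optimal_price (hD.hasDensityOn i) (hD.monotoneOn_virtualDensity i)
  refine ⟨θ, hθ, hD.isFeasible_postedMechanism fun i => (E.lo_nonneg i i).trans (hθ i).1,
    fun M hM => ?_⟩
  rw [hD.revenue_postedMechanism]
  exact revenue_le_of_isFeasible hD hM hopt

end

end Auction

/-! ### The uniform noise -/

lemma integral_unif (g : ℝ → ℝ) : ∫ u, g u ∂unif = 2⁻¹ * ∫ u in (-1 : ℝ)..1, g u := by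
  rw [unif, integral_smul_measure, intervalIntegral.integral_of_le (by norm_num),
    integral_Icc_eq_integral_Ioc]
  simp

instance isProbabilityMeasure_unif : IsProbabilityMeasure unif := by
  constructor
  have : (1 : ℝ) - -1 = 2 := by norm_num
  simp only [unif, Measure.smul_apply, Measure.restrict_apply_univ, Real.volume_Icc, this,
    smul_eq_mul, ENNReal.ofReal_ofNat]
  exact ENNReal.inv_mul_cancel (by norm_num) (by norm_num)

lemma ae_unif_mem : ∀ᵐ u ∂unif, u ∈ Set.Icc (-1 : ℝ) 1 :=
  Measure.ae_smul_measure (ae_restrict_mem measurableSet_Icc) _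

lemma integral_unif_id : ∫ u, u ∂unif = 0 := by
  rw [integral_unif, integral_id]; norm_num

/-- This variance is the source of the factors `3` in the regret bounds. -/
lemma integral_unif_sq : ∫ u, u ^ 2 ∂unif = 1 / 3 := by
  rw [integral_unif, integral_pow]; norm_num

/-! ### One-point gradient steps for a concave function -/

section Concave

variable {a b L δ : ℝ} {G ψ : ℝ → ℝ}
  (hG : ∀ x ∈ Set.Icc a b, ∀ y ∈ Set.Icc a b, G y ≤ G x + ψ x * (y - x))
  (hψ : ∀ x ∈ Set.Icc a b, |ψ x| ≤ L)
include hG hψ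

lemma abs_sub_le_of_supergradient {x y : ℝ} (hx : x ∈ Set.Icc a b) (hy : y ∈ Set.Icc a b) :
    |G x - G y| ≤ L * |x - y| := by
  have key : ∀ x ∈ Set.Icc a b, ∀ y ∈ Set.Icc a b, G y - G x ≤ L * |x - y| := by
    intro x hx y hy
    have h1 := hG x hx y hy
    have h2 : ψ x * (y - x) ≤ L * |x - y| := by
      refine (le_abs_self _).trans ?_
      rw [abs_mul, abs_sub_comm y x]
      exact mul_le_mul_of_nonneg_right (hψ x hx) (abs_nonneg _)
    linarith
  rw [abs_le]
  have h1 := key x hx y hy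
  have h2 := key y hy x hx
  rw [abs_sub_comm] at h2
  constructor <;> linarith

/-- Secants of a concave function towards `θ`, up to the exploration radius `δ`. -/
lemma one_point_inequality (hδ : 0 < δ) {τ θ u : ℝ} (hu : u ∈ Set.Icc (-1 : ℝ) 1)
    (hτ : τ ∈ Set.Icc (a + δ) (b - δ)) (hθ : θ ∈ Set.Icc a b) :
    u ^ 2 * (G θ - G τ) - 2 * L * δ ≤ (G (τ + δ * u) - G τ) * u * (θ - τ) / δ := by
  have hτ' : τ ∈ Set.Icc a b := ⟨by linarith [hτ.1], by linarith [hτ.2]⟩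
  have hp : τ + δ * u ∈ Set.Icc a b :=
    ⟨by nlinarith [hτ.1, hu.1], by nlinarith [hτ.2, hu.2]⟩
  have hL : 0 ≤ L := (abs_nonneg _).trans (hψ τ hτ')
  have hu2 : u ^ 2 ≤ 1 := by nlinarith [hu.1, hu.2]
  have hua : |u| ≤ 1 := abs_le.2 hu
  -- If `θ` is within `δ` of `τ`, both main terms are at most `L δ` in size; this is the origin of
  -- `2 L δ`. Otherwise no error is needed.
  rcases le_or_gt |θ - τ| δ with hd | hd
  · have h1 : u ^ 2 * (G θ - G τ) ≤ L * δ := by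
      have h := (le_abs_self _).trans (abs_sub_le_of_supergradient hG hψ hθ hτ')
      have h' : L * |θ - τ| ≤ L * δ := by gcongr
      calc u ^ 2 * (G θ - G τ) ≤ u ^ 2 * (L * δ) := by gcongr; linarith
        _ ≤ 1 * (L * δ) := by gcongr
        _ = L * δ := one_mul _
    have h2 : |(G (τ + δ * u) - G τ) * u * (θ - τ) / δ| ≤ L * δ := by
      have h := abs_sub_le_of_supergradient hG hψ hp hτ'
      have e : τ + δ * u - τ = δ * u := by ring
      rw [e, abs_mul, abs_of_pos hδ] at h
      rw [abs_div, abs_mul, abs_mul, abs_of_pos hδ, div_le_iff₀ hδ]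
      calc _ ≤ (L * (δ * 1)) * 1 * δ := by
            gcongr
            exact h.trans (by gcongr)
        _ = L * δ * δ := by ring
    have := (abs_le.1 h2).1
    linarith
  · suffices δ * u * (δ * u) * (G θ - G τ) ≤ (G (τ + δ * u) - G τ) * (δ * u) * (θ - τ) by
      have h : u ^ 2 * (G θ - G τ) ≤ (G (τ + δ * u) - G τ) * u * (θ - τ) / δ := by
        rw [le_div_iff₀ hδ]
        refine le_of_mul_le_mul_left ?_ hδ
        linarith
      have : 0 ≤ 2 * L * δ := by positivity
      linarith
    have he : |δ * u| ≤ |θ - τ| := by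
      rw [abs_mul, abs_of_pos hδ]
      exact (mul_le_of_le_one_right hδ.le hua).trans hd.le
    generalize hed : δ * u = e at *
    -- Either `τ + e` lies between `τ` and `θ`, or `τ` lies between `τ + e` and `θ`. In each case
    -- concavity is used at the middle point, to compare the two secants through `τ`.
    rcases le_or_gt 0 (e * (θ - τ)) with hs | hs
    · have h1 := hG _ hp τ hτ'
      have h2 := hG _ hp θ hθ
      have h3 : 0 ≤ e * (θ - τ) - e * e := by
        have : e * e ≤ e * (θ - τ) := by
          rw [← abs_of_nonneg hs, abs_mul, ← abs_mul_abs_self]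
          gcongr
        linarith
      have h4 := mul_le_mul_of_nonneg_left h1 h3
      have h5 := mul_le_mul_of_nonneg_left h2 (mul_self_nonneg e)
      nlinarith
    · have h1 := hG τ hτ' _ hp
      have h2 := hG τ hτ' θ hθ
      have h4 := mul_le_mul_of_nonpos_left h1 hs.le
      have h5 := mul_le_mul_of_nonneg_left h2 (mul_self_nonneg e)
      nlinarith

end Concave

lemma sq_projection_sub_le {l h y θ : ℝ} (hθ : θ ∈ Set.Icc l h) :
    (max l (min h y) - θ) ^ 2 ≤ (y - θ) ^ 2 := by
  obtain ⟨h1, h2⟩ := hθ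
  rcases le_total h y with hy | hy
  · rw [min_eq_left hy, max_eq_right (h1.trans h2)]
    nlinarith
  · rw [min_eq_right hy]
    rcases le_total l y with hl | hl
    · rw [max_eq_right hl]
    · rw [max_eq_left hl]
      nlinarith

/-! ### Expected progress of one step -/

/-- The next threshold of bidder `i`, as a function of her value `q.1` and the noise `q.2`. -/
def thresholdStep (E : Market N) (δ γ : ℝ) (i : N) (τ : ℝ) (q : ℝ × ℝ) : ℝ :=
  gradientUpdate E δ γ i τ q.2 (decision (τ + δ * q.2) q.1)

lemma measurable_thresholdStep (E : Market N) (δ γ : ℝ) (i : N) :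
    Measurable fun z : ℝ × ℝ × ℝ => thresholdStep E δ γ i z.1 z.2 := by
  have h : Measurable fun z : ℝ × ℝ × ℝ => decision (z.1 + δ * z.2.2) z.2.1 :=
    measurable_decision.comp (by fun_prop : Measurable fun z : ℝ × ℝ × ℝ =>
      (z.1 + δ * z.2.2, z.2.1))
  unfold thresholdStep gradientUpdate oracle
  fun_prop

lemma thresholdStep_mem (E : Market N) {δ : ℝ} (γ : ℝ) {i : N} (h : 2 * δ ≤ E.hi i i - E.lo i i)
    (τ : ℝ) (q : ℝ × ℝ) :
    thresholdStep E δ γ i τ q ∈ Set.Icc (E.lo i i + δ) (E.hi i i - δ) :=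
  ⟨le_max_left _ _, max_le (by linarith) (min_le_left _ _)⟩

/-- A bound for the oracle answers. -/
def oracleBound (E : Market N) (i : N) : ℝ := |E.lo i i| + |E.hi i i| + |E.totalExt i|

lemma abs_oracle_le (E : Market N) (i : N) {p : ℝ} (hp : p ∈ Set.Icc (E.lo i i) (E.hi i i))
    (v : ℝ) : |oracle E i p (decision p v)| ≤ oracleBound E i := by
  have h1 := abs_le_max_abs_abs hp.1 hp.2
  have h2 := max_le_add_of_nonneg (abs_nonneg (E.lo i i)) (abs_nonneg (E.hi i i))
  have h3 := abs_nonneg (E.totalExt i)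
  unfold oracle decision oracleBound
  split_ifs
  · simp only [sub_self, zero_mul, sub_zero]; linarith
  · simp only [sub_zero, one_mul, sub_sub_cancel]
    linarith [abs_nonneg (E.lo i i), abs_nonneg (E.hi i i)]

lemma measurable_netRevenue (ν : Measure ℝ) [IsFiniteMeasure ν] (S : ℝ) :
    Measurable (netRevenue ν S) :=
  (measurable_id.sub_const S).mul
    (Antitone.measurable fun _ _ hpq => measureReal_mono (Set.Ici_subset_Ici.2 hpq))

section Step

variable {E : Market N} {i : N} {ν : Measure ℝ} [IsProbabilityMeasure ν] {f : ℝ → ℝ}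

/-- The oracle equals `S + (p - S) X`: an unbiased estimate of the net revenue, up to a constant,
that needs only known means. -/
lemma integral_oracle (E : Market N) (i : N) (ν : Measure ℝ) [IsProbabilityMeasure ν] (p : ℝ) :
    ∫ v, oracle E i p (decision p v) ∂ν = netRevenue ν (E.totalExt i) p + E.totalExt i := by
  have hi : Integrable (decision p) ν :=
    integrable_of_measurable_of_ae_bound (measurable_decision_right p) 1 (.of_forall fun v => by
      rw [abs_of_nonneg (decision_mem p v).1]; exact (decision_mem p v).2)
  have e : ∀ v, oracle E i p (decision p v)
      = E.totalExt i + (p - E.totalExt i) * decision p v := by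
    intro v; unfold oracle; ring
  simp only [e]
  rw [integral_add (integrable_const _) (hi.const_mul _), integral_const_mul, integral_decision]
  simp [netRevenue]; ring

lemma netRevenue_abs_le {a b S p : ℝ} (hp : p ∈ Set.Icc a b) :
    |netRevenue ν S p| ≤ |a| + |b| + |S| := by
  rw [netRevenue, abs_mul, abs_of_nonneg measureReal_nonneg]
  have h1 := abs_le_max_abs_abs hp.1 hp.2
  have h2 := max_le_add_of_nonneg (abs_nonneg a) (abs_nonneg b)
  have h3 := abs_sub p S
  calc |p - S| * ν.real (Set.Ici p) ≤ |p - S| * 1 := by gcongr; exact measureReal_le_one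
    _ ≤ _ := by linarith

variable {L δ γ : ℝ} {ψ : ℝ → ℝ}
  (hG : ∀ x ∈ Set.Icc (E.lo i i) (E.hi i i), ∀ y ∈ Set.Icc (E.lo i i) (E.hi i i),
    netRevenue ν (E.totalExt i) y ≤ netRevenue ν (E.totalExt i) x + ψ x * (y - x))
  (hψ : ∀ x ∈ Set.Icc (E.lo i i) (E.hi i i), |ψ x| ≤ L)
  (hδ : 0 < δ)
include hG hψ hδ

omit [IsProbabilityMeasure ν] hG hψ in
lemma posted_mem {τ u : ℝ} (hτ : τ ∈ Set.Icc (E.lo i i + δ) (E.hi i i - δ))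
    (hu : u ∈ Set.Icc (-1 : ℝ) 1) : τ + δ * u ∈ Set.Icc (E.lo i i) (E.hi i i) :=
  ⟨by nlinarith [hτ.1, hu.1], by nlinarith [hτ.2, hu.2]⟩

/-- The expected oracle step points towards `θ` as far as `θ` improves on `τ`. -/
lemma expected_oracle_inequality {τ θ : ℝ} (hτ : τ ∈ Set.Icc (E.lo i i + δ) (E.hi i i - δ))
    (hθ : θ ∈ Set.Icc (E.lo i i) (E.hi i i)) :
    1 / 3 * (netRevenue ν (E.totalExt i) θ - netRevenue ν (E.totalExt i) τ) - 2 * L * δ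
      ≤ (θ - τ) / δ * ∫ q, oracle E i (τ + δ * q.2) (decision (τ + δ * q.2) q.1) * q.2
        ∂(ν.prod unif) := by
  set S := E.totalExt i
  set B := |E.lo i i| + |E.hi i i| + |S|
  have hGm : Measurable fun u => netRevenue ν S (τ + δ * u) :=
    (measurable_netRevenue ν S).comp (by fun_prop)
  have hGi : Integrable (fun u => netRevenue ν S (τ + δ * u) * u) unif := by
    refine integrable_of_measurable_of_ae_bound (hGm.mul measurable_id) (B * 1) ?_
    filter_upwards [ae_unif_mem] with u hu
    rw [abs_mul]
    exact mul_le_mul (netRevenue_abs_le (posted_mem hδ hτ hu)) (abs_le.2 hu) (abs_nonneg _)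
      (by positivity)
  have hid : Integrable (fun u : ℝ => u) unif :=
    integrable_of_measurable_of_ae_bound measurable_id 1 (by
      filter_upwards [ae_unif_mem] with u hu using abs_le.2 hu)
  have hsq : Integrable (fun u : ℝ => u ^ 2) unif :=
    integrable_of_measurable_of_ae_bound (by fun_prop) 1 (by
      filter_upwards [ae_unif_mem] with u hu
      rw [abs_of_nonneg (sq_nonneg u)]
      nlinarith [hu.1, hu.2])
  have hO : Integrable (fun q : ℝ × ℝ =>
      oracle E i (τ + δ * q.2) (decision (τ + δ * q.2) q.1) * q.2) (ν.prod unif) := by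
    have hm : Measurable fun q : ℝ × ℝ => decision (τ + δ * q.2) q.1 :=
      measurable_decision.comp (by fun_prop : Measurable fun q : ℝ × ℝ => (τ + δ * q.2, q.1))
    refine integrable_of_measurable_of_ae_bound (by unfold oracle; fun_prop) (B * 1) ?_
    filter_upwards [Measure.quasiMeasurePreserving_snd.ae ae_unif_mem] with q hu
    rw [abs_mul]
    exact mul_le_mul (abs_oracle_le E i (posted_mem hδ hτ hu) _) (abs_le.2 hu) (abs_nonneg _)
      (by positivity)
  -- Average over the value first; the constant `S` then vanishes because the noise is centred. For
  -- the same reason `G τ` can be subtracted for free in `e2`.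
  have e : ∫ q, oracle E i (τ + δ * q.2) (decision (τ + δ * q.2) q.1) * q.2 ∂(ν.prod unif)
      = ∫ u, netRevenue ν S (τ + δ * u) * u ∂unif := by
    rw [integral_prod_symm _ hO]
    simp only [integral_mul_const, integral_oracle]
    have : ∀ u : ℝ, (netRevenue ν (E.totalExt i) (τ + δ * u) + E.totalExt i) * u
        = netRevenue ν S (τ + δ * u) * u + S * u := fun u => by ring
    simp only [this]
    rw [integral_add hGi (hid.const_mul S), integral_const_mul, integral_unif_id]
    ring
  have e2 : ∫ u, ((netRevenue ν S (τ + δ * u) - netRevenue ν S τ) * u * (θ - τ) / δ) ∂unif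
      = (θ - τ) / δ * ∫ u, netRevenue ν S (τ + δ * u) * u ∂unif := by
    have : ∀ u : ℝ, (netRevenue ν S (τ + δ * u) - netRevenue ν S τ) * u * (θ - τ) / δ
        = (θ - τ) / δ * (netRevenue ν S (τ + δ * u) * u - netRevenue ν S τ * u) := fun u => by ring
    simp only [this]
    rw [integral_const_mul, integral_sub hGi (hid.const_mul _), integral_const_mul,
      integral_unif_id]
    ring
  have e3 : ∫ u, (u ^ 2 * (netRevenue ν S θ - netRevenue ν S τ) - 2 * L * δ) ∂unif
      = 1 / 3 * (netRevenue ν S θ - netRevenue ν S τ) - 2 * L * δ := by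
    rw [integral_sub (hsq.mul_const _) (integrable_const _), integral_mul_const, integral_unif_sq]
    simp
  rw [e, ← e2, ← e3]
  refine integral_mono_ae ((hsq.mul_const _).sub (integrable_const _)) ?_ ?_
  · have : ∀ u : ℝ, (netRevenue ν S (τ + δ * u) - netRevenue ν S τ) * u * (θ - τ) / δ
        = (netRevenue ν S (τ + δ * u) * u - netRevenue ν S τ * u) * ((θ - τ) / δ) := fun u => by
      ring
    simp only [this]
    exact (hGi.sub (hid.const_mul _)).mul_const _
  · filter_upwards [ae_unif_mem] with u hu
    exact one_point_inequality hG hψ hδ hu hτ hθ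

/-- Expected loss of the posted price against `θ`, by the progress of the threshold towards `θ`. -/
lemma expected_step_inequality (hγ : 0 < γ) {τ θ : ℝ}
    (hτ : τ ∈ Set.Icc (E.lo i i + δ) (E.hi i i - δ))
    (hθ : θ ∈ Set.Icc (E.lo i i + δ) (E.hi i i - δ)) :
    ∫ q, (netRevenue ν (E.totalExt i) θ - netRevenue ν (E.totalExt i) (τ + δ * q.2))
        ∂(ν.prod unif)
      ≤ 7 * L * δ + 3 * γ * oracleBound E i ^ 2 / (2 * δ ^ 2)
        + 3 / (2 * γ) * ((τ - θ) ^ 2 - ∫ q, (thresholdStep E δ γ i τ q - θ) ^ 2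
          ∂(ν.prod unif)) := by
  set S := E.totalExt i with hS
  set B := oracleBound E i with hB
  set H : ℝ × ℝ → ℝ := fun q => oracle E i (τ + δ * q.2) (decision (τ + δ * q.2) q.1) * q.2 with hH
  have hab : 2 * δ ≤ E.hi i i - E.lo i i := by linarith [hτ.1, hτ.2]
  have hθ' : θ ∈ Set.Icc (E.lo i i) (E.hi i i) := ⟨by linarith [hθ.1], by linarith [hθ.2]⟩
  have hτ' : τ ∈ Set.Icc (E.lo i i) (E.hi i i) := ⟨by linarith [hτ.1], by linarith [hτ.2]⟩
  have hL : 0 ≤ L := (abs_nonneg _).trans (hψ τ hτ')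
  have hq : ∀ᵐ q ∂(ν.prod unif), q.2 ∈ Set.Icc (-1 : ℝ) 1 :=
    Measure.quasiMeasurePreserving_snd.ae ae_unif_mem
  have hHm : Measurable H := by
    have hm : Measurable fun q : ℝ × ℝ => decision (τ + δ * q.2) q.1 :=
      measurable_decision.comp (by fun_prop : Measurable fun q : ℝ × ℝ => (τ + δ * q.2, q.1))
    unfold H oracle; fun_prop
  have hHb : ∀ᵐ q ∂(ν.prod unif), |H q| ≤ B := by
    filter_upwards [hq] with q hu
    have hB0 : 0 ≤ B := (abs_nonneg _).trans (abs_oracle_le E i hτ' 0)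
    calc |H q| = _ := abs_mul _ _
      _ ≤ B * 1 := mul_le_mul (abs_oracle_le E i (posted_mem hδ hτ hu) _) (abs_le.2 hu)
          (abs_nonneg _) hB0
      _ = B := mul_one B
  have hHi : Integrable H (ν.prod unif) := integrable_of_measurable_of_ae_bound hHm B hHb
  have hstepm : Measurable fun q => (thresholdStep E δ γ i τ q - θ) ^ 2 :=
    (((measurable_thresholdStep E δ γ i).comp
      (measurable_const.prodMk measurable_id)).sub_const θ).pow_const 2
  have hstepi : Integrable (fun q => (thresholdStep E δ γ i τ q - θ) ^ 2) (ν.prod unif) := by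
    refine integrable_of_measurable_of_ae_bound hstepm ((E.hi i i - E.lo i i) ^ 2)
      (.of_forall fun q => ?_)
    have := thresholdStep_mem E γ hab τ q
    rw [abs_of_nonneg (sq_nonneg _)]
    exact sq_le_sq' (by linarith [this.1, hθ'.2]) (by linarith [this.2, hθ'.1])
  have h1 : ∫ q, (thresholdStep E δ γ i τ q - θ) ^ 2 ∂(ν.prod unif)
      ≤ (τ - θ) ^ 2 + γ ^ 2 * B ^ 2 / δ ^ 2 - 2 * γ * ((θ - τ) / δ * ∫ q, H q ∂(ν.prod unif)) := by
    have e : ∫ q, ((τ - θ) ^ 2 + γ ^ 2 * B ^ 2 / δ ^ 2 - 2 * γ * ((θ - τ) / δ * H q)) ∂(ν.prod unif)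
        = (τ - θ) ^ 2 + γ ^ 2 * B ^ 2 / δ ^ 2
          - 2 * γ * ((θ - τ) / δ * ∫ q, H q ∂(ν.prod unif)) := by
      rw [integral_sub (integrable_const _) ((hHi.const_mul _).const_mul _), integral_const_mul,
        integral_const_mul]
      simp
    rw [← e]
    refine integral_mono_ae hstepi
      ((integrable_const _).sub ((hHi.const_mul _).const_mul _)) ?_
    filter_upwards [hHb] with q hHq
    have h2 : (thresholdStep E δ γ i τ q - θ) ^ 2 ≤ (τ + γ * H q / δ - θ) ^ 2 := by
      have := sq_projection_sub_le (y := τ + γ * oracle E i (τ + δ * q.2)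
        (decision (τ + δ * q.2) q.1) * q.2 / δ) hθ
      simp only [hH, ← mul_assoc]
      exact this
    have h3 : H q ^ 2 ≤ B ^ 2 := sq_le_sq' (abs_le.1 hHq).1 (abs_le.1 hHq).2
    have h4 : γ ^ 2 * H q ^ 2 / δ ^ 2 ≤ γ ^ 2 * B ^ 2 / δ ^ 2 := by gcongr
    have h5 : (τ + γ * H q / δ - θ) ^ 2
        = (τ - θ) ^ 2 + γ ^ 2 * H q ^ 2 / δ ^ 2 - 2 * γ * ((θ - τ) / δ * H q) := by
      field_simp; ring
    linarith
  have h2 := expected_oracle_inequality hG hψ hδ hτ hθ'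
  -- Cost of exploration: the price posted is `τ + δ u`, not `τ`.
  have h3 : ∫ q, (netRevenue ν S θ - netRevenue ν S (τ + δ * q.2)) ∂(ν.prod unif)
      ≤ netRevenue ν S θ - netRevenue ν S τ + L * δ := by
    have e : ∫ _, (netRevenue ν S θ - netRevenue ν S τ + L * δ) ∂(ν.prod unif)
        = netRevenue ν S θ - netRevenue ν S τ + L * δ := by simp
    rw [← e]
    refine integral_mono_ae ?_ (integrable_const _) ?_
    · refine (integrable_const _).sub (integrable_of_measurable_of_ae_bound
        ((measurable_netRevenue ν S).comp (by fun_prop)) (|E.lo i i| + |E.hi i i| + |S|) ?_)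
      filter_upwards [hq] with q hu using netRevenue_abs_le (posted_mem hδ hτ hu)
    · filter_upwards [hq] with q hu
      have h := (le_abs_self _).trans
        (abs_sub_le_of_supergradient hG hψ hτ' (posted_mem hδ hτ hu))
      have e : τ - (τ + δ * q.2) = -(δ * q.2) := by ring
      rw [e, abs_neg, abs_mul, abs_of_pos hδ] at h
      have : L * (δ * |q.2|) ≤ L * δ := by
        gcongr
        exact mul_le_of_le_one_right hδ.le (abs_le.2 hu)
      linarith
  set J := (θ - τ) / δ * ∫ q, H q ∂(ν.prod unif)
  set Φ := ∫ q, (thresholdStep E δ γ i τ q - θ) ^ 2 ∂(ν.prod unif)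
  have h4 : J ≤ γ * B ^ 2 / (2 * δ ^ 2) + 1 / (2 * γ) * ((τ - θ) ^ 2 - Φ) := by
    have : 2 * γ * J ≤ (τ - θ) ^ 2 - Φ + γ ^ 2 * B ^ 2 / δ ^ 2 := by linarith
    have h5 : J ≤ ((τ - θ) ^ 2 - Φ + γ ^ 2 * B ^ 2 / δ ^ 2) / (2 * γ) := by
      rw [le_div_iff₀ (by positivity)]; linarith
    refine h5.trans_eq ?_
    field_simp
    ring
  -- Clearing the factor `1 / 3` turns `2 L δ` into `6 L δ`; exploration makes it `7 L δ`.
  have h6 : 3 * γ * B ^ 2 / (2 * δ ^ 2) + 3 / (2 * γ) * ((τ - θ) ^ 2 - Φ)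
      = 3 * (γ * B ^ 2 / (2 * δ ^ 2) + 1 / (2 * γ) * ((τ - θ) ^ 2 - Φ)) := by ring
  linarith

end Step

/-! ### Independence of the current state and the current sample -/

section Recursion

variable {Ω α β : Type*} [MeasurableSpace Ω] [MeasurableSpace α] [MeasurableSpace β]
  {P : Measure Ω} {q : ℕ → Ω → α} {x : ℕ → Ω → β} {F : β → α → β} {c : β}

lemma indepFun_of_recursion (hq : ∀ k, Measurable (q k)) (hind : iIndepFun q P)
    (hF : Measurable fun z : β × α => F z.1 z.2) (h0 : ∀ ω, x 0 ω = c)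
    (hx : ∀ k ω, x (k + 1) ω = F (x k ω) (q k ω)) (k : ℕ) :
    Measurable (x k) ∧ IndepFun (x k) (q k) P := by
  -- The state at step `k` is a function of the samples strictly before `k`.
  have hmeas : ∀ k, Measurable[⨆ l ∈ Set.Iio k, MeasurableSpace.comap (q l) inferInstance]
      (x k) := by
    intro k
    induction k with
    | zero =>
      have : x 0 = fun _ => c := funext h0
      rw [this]
      exact measurable_const
    | succ k ih =>
      have : x (k + 1) = (fun z : β × α => F z.1 z.2) ∘ fun ω => (x k ω, q k ω) :=
        funext (hx k)
      rw [this]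
      refine hF.comp (Measurable.prodMk ?_ ?_)
      · exact ih.mono (biSup_mono fun l (hl : l < k) => Nat.lt_succ_of_lt hl) le_rfl
      · refine Measurable.mono (comap_measurable (q k)) ?_ le_rfl
        exact le_biSup (fun l => MeasurableSpace.comap (q l) inferInstance) (Nat.lt_succ_self k)
  have hle : ∀ k, MeasurableSpace.comap (q k) inferInstance ≤ (inferInstance : MeasurableSpace Ω) :=
    fun k => (hq k).comap_le
  refine ⟨(hmeas k).mono (iSup₂_le fun l _ => hle l) le_rfl, ?_⟩
  have h := indep_iSup_of_disjoint hle hind (S := Set.Iio k) (T := {k})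
    (Set.disjoint_singleton_right.2 (lt_irrefl k))
  rw [IndepFun_iff_Indep]
  refine indep_of_indep_of_le_left (indep_of_indep_of_le_right h ?_) (hmeas k).comap_le
  simp

end Recursion

/-- Conditioning on `X` by Fubini on the joint law, instead of a conditional expectation. -/
lemma integral_le_of_indepFun {Ω α β : Type*} [MeasurableSpace Ω] [MeasurableSpace α]
    [MeasurableSpace β] {P : Measure Ω} [IsProbabilityMeasure P] {X : Ω → α} {Y : Ω → β}
    (hX : Measurable X) (hY : Measurable Y) (hXY : IndepFun X Y P) {g : α × β → ℝ}
    (hg : Measurable g) (hi : Integrable (fun ω => g (X ω, Y ω)) P) {I : Set α}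
    (hI : MeasurableSet I) (hXI : ∀ ω, X ω ∈ I) {c : ℝ}
    (hc : ∀ x ∈ I, ∫ y, g (x, y) ∂(P.map Y) ≤ c) : ∫ ω, g (X ω, Y ω) ∂P ≤ c := by
  have hXY' : Measurable fun ω => (X ω, Y ω) := hX.prodMk hY
  have hlaw := (indepFun_iff_map_prod_eq_prod_map_map hX.aemeasurable hY.aemeasurable).1 hXY
  have := Measure.isProbabilityMeasure_map (μ := P) hX.aemeasurable
  have := Measure.isProbabilityMeasure_map (μ := P) hY.aemeasurable
  have hi' : Integrable g ((P.map X).prod (P.map Y)) := by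
    rw [← hlaw, integrable_map_measure hg.aestronglyMeasurable hXY'.aemeasurable]
    exact hi
  rw [← integral_map (f := g) hXY'.aemeasurable hg.aestronglyMeasurable, hlaw, integral_prod _ hi']
  have e : ∫ _, c ∂(P.map X) = c := by simp
  rw [← e]
  refine integral_mono_ae hi'.integral_prod_left (integrable_const c) ?_
  have : ∀ᵐ x ∂(P.map X), x ∈ I :=
    (ae_map_iff hX.aemeasurable hI).2 (.of_forall hXI)
  filter_upwards [this] with x hx using hc x hx

/-! ### Regret from a single bidder -/

section Bidder

variable {E : Market N} {i : N} {ν : Measure ℝ} [IsProbabilityMeasure ν]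
  {Ω : Type*} [MeasurableSpace Ω] {P : Measure Ω} [IsProbabilityMeasure P]
  {L δ γ : ℝ} {ψ : ℝ → ℝ} {q : ℕ → Ω → ℝ × ℝ} {x : ℕ → Ω → ℝ} {τ₁ : ℝ}

lemma threshold_mem {x : ℕ → Ω → ℝ} (hτ₁ : τ₁ ∈ Set.Icc (E.lo i i + δ) (E.hi i i - δ))
    (h0 : ∀ ω, x 0 ω = τ₁)
    (hx : ∀ k ω, x (k + 1) ω = thresholdStep E δ γ i (x k ω) (q k ω)) (k : ℕ) (ω : Ω) :
    x k ω ∈ Set.Icc (E.lo i i + δ) (E.hi i i - δ) := by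
  cases k with
  | zero => rw [h0]; exact hτ₁
  | succ k => rw [hx]; exact thresholdStep_mem E γ (by linarith [hτ₁.1, hτ₁.2]) _ _

lemma ae_noise_mem (hq : ∀ k, Measurable (q k)) (hlaw : ∀ k, P.map (q k) = ν.prod unif) (k : ℕ) :
    ∀ᵐ ω ∂P, (q k ω).2 ∈ Set.Icc (-1 : ℝ) 1 := by
  have h : ∀ᵐ z ∂(P.map (q k)), z.2 ∈ Set.Icc (-1 : ℝ) 1 := by
    rw [hlaw]; exact Measure.quasiMeasurePreserving_snd.ae ae_unif_mem
  exact ae_of_ae_map (hq k).aemeasurable h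

lemma integrable_netRevenue_posted (hδ : 0 < δ) (hq : ∀ k, Measurable (q k))
    (hlaw : ∀ k, P.map (q k) = ν.prod unif)
    (hτ₁ : τ₁ ∈ Set.Icc (E.lo i i + δ) (E.hi i i - δ)) (h0 : ∀ ω, x 0 ω = τ₁)
    (hx : ∀ k ω, x (k + 1) ω = thresholdStep E δ γ i (x k ω) (q k ω))
    (hxm : ∀ k, Measurable (x k)) (S θ : ℝ) (k : ℕ) :
    Integrable (fun ω => netRevenue ν S θ - netRevenue ν S (x k ω + δ * (q k ω).2)) P := by
  have hm : Measurable fun ω => x k ω + δ * (q k ω).2 :=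
    (hxm k).add ((measurable_snd.comp (hq k)).const_mul δ)
  refine (integrable_const _).sub (integrable_of_measurable_of_ae_bound
    ((measurable_netRevenue ν S).comp hm) (|E.lo i i| + |E.hi i i| + |S|) ?_)
  filter_upwards [ae_noise_mem hq hlaw k] with ω hω
  exact netRevenue_abs_le (posted_mem hδ (threshold_mem hτ₁ h0 hx k ω) hω)

variable (hG : ∀ x ∈ Set.Icc (E.lo i i) (E.hi i i), ∀ y ∈ Set.Icc (E.lo i i) (E.hi i i),
    netRevenue ν (E.totalExt i) y ≤ netRevenue ν (E.totalExt i) x + ψ x * (y - x))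
  (hψ : ∀ x ∈ Set.Icc (E.lo i i) (E.hi i i), |ψ x| ≤ L)
  (hδ : 0 < δ) (hγ : 0 < γ)
  (hq : ∀ k, Measurable (q k)) (hlaw : ∀ k, P.map (q k) = ν.prod unif) (hind : iIndepFun q P)
  (hτ₁ : τ₁ ∈ Set.Icc (E.lo i i + δ) (E.hi i i - δ)) (h0 : ∀ ω, x 0 ω = τ₁)
  (hx : ∀ k ω, x (k + 1) ω = thresholdStep E δ γ i (x k ω) (q k ω))
include hG hψ hδ hγ hq hlaw hind hτ₁ h0 hx

lemma sum_integral_netRevenue_sub_le {θ : ℝ}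
    (hθ : θ ∈ Set.Icc (E.lo i i + δ) (E.hi i i - δ)) (K : ℕ) :
    ∑ k ∈ Finset.range K, ∫ ω, (netRevenue ν (E.totalExt i) θ
        - netRevenue ν (E.totalExt i) (x k ω + δ * (q k ω).2)) ∂P
      ≤ K * (7 * L * δ + 3 * γ * oracleBound E i ^ 2 / (2 * δ ^ 2))
        + 3 / (2 * γ) * (E.hi i i - E.lo i i) ^ 2 := by
  set S := E.totalExt i
  have hrec := indepFun_of_recursion hq hind (measurable_thresholdStep E δ γ i) h0 hx
  have hmem := threshold_mem hτ₁ h0 hx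
  have hsqb : ∀ k ω, (x k ω - θ) ^ 2 ≤ (E.hi i i - E.lo i i) ^ 2 := fun k ω =>
    sq_le_sq' (by linarith [(hmem k ω).1, hθ.2]) (by linarith [(hmem k ω).2, hθ.1])
  have hsqi : ∀ k, Integrable (fun ω => (x k ω - θ) ^ 2) P := fun k =>
    integrable_of_measurable_of_ae_bound (((hrec k).1.sub_const θ).pow_const 2)
      ((E.hi i i - E.lo i i) ^ 2)
      (.of_forall fun ω => by rw [abs_of_nonneg (sq_nonneg _)]; exact hsqb k ω)
  have hri := integrable_netRevenue_posted hδ hq hlaw hτ₁ h0 hx (fun k => (hrec k).1) S θ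
  have hstep : ∀ k ∈ Finset.range K,
      ∫ ω, (netRevenue ν S θ - netRevenue ν S (x k ω + δ * (q k ω).2)) ∂P
      ≤ (7 * L * δ + 3 * γ * oracleBound E i ^ 2 / (2 * δ ^ 2))
        + 3 / (2 * γ) * (∫ ω, (x k ω - θ) ^ 2 ∂P - ∫ ω, (x (k + 1) ω - θ) ^ 2 ∂P) := by
    intro k _
    -- Loss minus progress, so that the one-step bound is a constant independent of the state.
    set g : ℝ × ℝ × ℝ → ℝ := fun z =>
      (netRevenue ν S θ - netRevenue ν S (z.1 + δ * z.2.2))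
        - 3 / (2 * γ) * ((z.1 - θ) ^ 2 - (thresholdStep E δ γ i z.1 z.2 - θ) ^ 2) with hg
    have hgm : Measurable g := by
      have h1 : Measurable fun z : ℝ × ℝ × ℝ => netRevenue ν S (z.1 + δ * z.2.2) :=
        (measurable_netRevenue ν S).comp (by fun_prop)
      have h2 := measurable_thresholdStep E δ γ i
      fun_prop
    have hge : ∀ ω, g (x k ω, q k ω)
        = (netRevenue ν S θ - netRevenue ν S (x k ω + δ * (q k ω).2))
          - 3 / (2 * γ) * ((x k ω - θ) ^ 2 - (x (k + 1) ω - θ) ^ 2) := fun ω => by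
      simp only [hg, hx]
    have hmi : Integrable (fun ω => 3 / (2 * γ) * ((x k ω - θ) ^ 2 - (x (k + 1) ω - θ) ^ 2)) P :=
      ((hsqi k).sub (hsqi (k + 1))).const_mul _
    have hmain := integral_le_of_indepFun (hrec k).1 (hq k) (hrec k).2 hgm
      (by simp only [hge]; exact (hri k).sub hmi) measurableSet_Icc (hmem k)
      (c := 7 * L * δ + 3 * γ * oracleBound E i ^ 2 / (2 * δ ^ 2)) (by
        intro τ hτ
        rw [hlaw]
        have h := expected_step_inequality hG hψ hδ hγ hτ hθ
        have hτ' : ∀ᵐ z ∂(ν.prod unif), z.2 ∈ Set.Icc (-1 : ℝ) 1 :=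
          Measure.quasiMeasurePreserving_snd.ae ae_unif_mem
        have hi1 : Integrable (fun z : ℝ × ℝ =>
            netRevenue ν S θ - netRevenue ν S (τ + δ * z.2)) (ν.prod unif) := by
          refine (integrable_const _).sub (integrable_of_measurable_of_ae_bound
            ((measurable_netRevenue ν S).comp (by fun_prop)) (|E.lo i i| + |E.hi i i| + |S|) ?_)
          filter_upwards [hτ'] with z hz using netRevenue_abs_le (posted_mem hδ hτ hz)
        have hi2 : Integrable (fun z => (thresholdStep E δ γ i τ z - θ) ^ 2) (ν.prod unif) := by
          refine integrable_of_measurable_of_ae_bound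
            ((((measurable_thresholdStep E δ γ i).comp
              (measurable_const.prodMk measurable_id)).sub_const θ).pow_const 2)
            ((E.hi i i - E.lo i i) ^ 2) (.of_forall fun z => ?_)
          have := thresholdStep_mem E γ (by linarith [hτ₁.1, hτ₁.2] :
            2 * δ ≤ E.hi i i - E.lo i i) τ z
          rw [abs_of_nonneg (sq_nonneg _)]
          exact sq_le_sq' (by linarith [this.1, hθ.2]) (by linarith [this.2, hθ.1])
        have hi3 : Integrable (fun z => 3 / (2 * γ)
            * ((τ - θ) ^ 2 - (thresholdStep E δ γ i τ z - θ) ^ 2)) (ν.prod unif) :=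
          ((integrable_const _).sub hi2).const_mul _
        simp only [hg]
        rw [integral_sub hi1 hi3, integral_const_mul, integral_sub (integrable_const _) hi2]
        simp only [integral_const, probReal_univ, one_smul]
        linarith)
    simp only [hge] at hmain
    rw [integral_sub (hri k) hmi, integral_const_mul, integral_sub (hsqi k) (hsqi (k + 1))] at hmain
    linarith
  refine (Finset.sum_le_sum hstep).trans ?_
  -- The squared distances telescope; only the initial one remains, at most the squared width of the
  -- value interval.
  rw [Finset.sum_add_distrib, ← Finset.mul_sum,
    Finset.sum_range_sub' fun k => ∫ ω, (x k ω - θ) ^ 2 ∂P]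
  simp only [Finset.sum_const, Finset.card_range, nsmul_eq_mul]
  have h1 : 0 ≤ ∫ ω, (x K ω - θ) ^ 2 ∂P := integral_nonneg fun ω => sq_nonneg _
  have h2 : ∫ ω, (x 0 ω - θ) ^ 2 ∂P ≤ (E.hi i i - E.lo i i) ^ 2 := by
    simp only [h0, integral_const, probReal_univ, one_smul]
    exact sq_le_sq' (by linarith [hτ₁.1, hθ.2]) (by linarith [hτ₁.2, hθ.1])
  gcongr
  linarith

/-- The best price may lie within `δ` of an endpoint, out of reach of the projection. Comparing with
its projection costs `L δ` per step, hence `8` in place of `7`. -/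
lemma sum_integral_netRevenue_sub_le_of_mem {θ : ℝ}
    (hθ : θ ∈ Set.Icc (E.lo i i) (E.hi i i)) (K : ℕ) :
    ∑ k ∈ Finset.range K, ∫ ω, (netRevenue ν (E.totalExt i) θ
        - netRevenue ν (E.totalExt i) (x k ω + δ * (q k ω).2)) ∂P
      ≤ K * (8 * L * δ + 3 * γ * oracleBound E i ^ 2 / (2 * δ ^ 2))
        + 3 / (2 * γ) * (E.hi i i - E.lo i i) ^ 2 := by
  set S := E.totalExt i
  have hrec := indepFun_of_recursion hq hind (measurable_thresholdStep E δ γ i) h0 hx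
  have hL : 0 ≤ L := (abs_nonneg _).trans (hψ θ hθ)
  obtain ⟨θ', hθ', hd⟩ : ∃ θ' ∈ Set.Icc (E.lo i i + δ) (E.hi i i - δ), |θ - θ'| ≤ δ := by
    have hlh : E.lo i i + δ ≤ E.hi i i - δ := hτ₁.1.trans hτ₁.2
    refine ⟨max (E.lo i i + δ) (min (E.hi i i - δ) θ),
      ⟨le_max_left _ _, max_le hlh (min_le_left _ _)⟩, ?_⟩
    rw [abs_le]
    rcases le_total (E.hi i i - δ) θ with h | h
    · rw [min_eq_left h, max_eq_right hlh]
      constructor <;> linarith [hθ.2]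
    · rw [min_eq_right h]
      rcases le_total (E.lo i i + δ) θ with h' | h'
      · rw [max_eq_right h']; constructor <;> linarith
      · rw [max_eq_left h']; constructor <;> linarith [hθ.1]
  have hθ'm : θ' ∈ Set.Icc (E.lo i i) (E.hi i i) := ⟨by linarith [hθ'.1], by linarith [hθ'.2]⟩
  have hdiff : netRevenue ν S θ - netRevenue ν S θ' ≤ L * δ :=
    ((le_abs_self _).trans (abs_sub_le_of_supergradient hG hψ hθ hθ'm)).trans (by gcongr)
  have h := sum_integral_netRevenue_sub_le hG hψ hδ hγ hq hlaw hind hτ₁ h0 hx hθ' K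
  have hle : ∀ k ∈ Finset.range K,
      ∫ ω, (netRevenue ν S θ - netRevenue ν S (x k ω + δ * (q k ω).2)) ∂P
      ≤ L * δ + ∫ ω, (netRevenue ν S θ' - netRevenue ν S (x k ω + δ * (q k ω).2)) ∂P := by
    intro k _
    have hi := fun θ => integrable_netRevenue_posted hδ hq hlaw hτ₁ h0 hx (fun k => (hrec k).1) S θ k
    have e : L * δ = ∫ _, L * δ ∂P := by simp
    rw [e, ← integral_add (integrable_const _) (hi θ')]
    refine integral_mono (hi θ) ((integrable_const _).add (hi θ')) fun ω => ?_
    simp only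
    linarith
  refine (Finset.sum_le_sum hle).trans ?_
  rw [Finset.sum_add_distrib]
  simp only [Finset.sum_const, Finset.card_range, nsmul_eq_mul]
  linarith

end Bidder

/-! ### The algorithm -/

lemma Market.exists_radius (E : Market N) : ∃ c : ℝ, 0 < c ∧ ∀ i, 2 * c ≤ E.hi i i - E.lo i i := by
  rcases isEmpty_or_nonempty N with h | h
  · exact ⟨1, one_pos, fun i => h.elim i⟩
  · obtain ⟨j, hj⟩ := Finite.exists_min fun i => E.hi i i - E.lo i i
    refine ⟨(E.hi j j - E.lo j j) / 2, by linarith [E.val_lt j], fun i => ?_⟩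
    linarith [hj i]

section Sampling

variable {E : Market N} {D : N → Measure (N → ℝ)} {f : N → ℝ → ℝ}
  {Ω : Type*} [MeasurableSpace Ω] {P : Measure Ω} [IsProbabilityMeasure P]
  {t : ℕ → Ω → N → N → ℝ} {u : ℕ → Ω → N → ℝ}

lemma measurable_value_noise (i : N) :
    Measurable fun z : (N → N → ℝ) × (N → ℝ) => (z.1 i i, z.2 i) := by fun_prop

lemma IsSampling.measurable_value_noise (h : IsSampling P D t u) (i : N) (k : ℕ) :
    Measurable fun ω => (t k ω i i, u k ω i) :=
  (DataAuction.measurable_value_noise i).comp ((h.measurable_types k).prodMk (h.measurable_noise k))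

lemma IsSampling.law_value_noise [∀ i, IsProbabilityMeasure (D i)] (h : IsSampling P D t u)
    (i : N) (k : ℕ) :
    P.map (fun ω => (t k ω i i, u k ω i)) = (valueLaw D i).prod unif := by
  have e : (fun ω => (t k ω i i, u k ω i))
      = (fun z : (N → N → ℝ) × (N → ℝ) => (z.1 i i, z.2 i)) ∘ fun ω => (t k ω, u k ω) := rfl
  rw [e, ← Measure.map_map (DataAuction.measurable_value_noise i)
    ((h.measurable_types k).prodMk (h.measurable_noise k)), h.law]
  have h1 : (Measure.pi D).map (fun t : N → N → ℝ => t i i) = valueLaw D i := by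
    rw [valueLaw, ← (measurePreserving_eval D i).map_eq,
      Measure.map_map (measurable_pi_apply i) (measurable_pi_apply i)]
    rfl
  have h2 : (Measure.pi fun _ : N => unif).map (fun u => u i) = unif :=
    (measurePreserving_eval (fun _ : N => unif) i).map_eq
  conv_rhs => rw [← h1, ← h2]
  exact (Measure.map_prod_map (f := fun t : N → N → ℝ => t i i) (g := fun u : N → ℝ => u i) _ _
    (by fun_prop) (by fun_prop)).symm

lemma IsSampling.iIndepFun_value_noise (h : IsSampling P D t u) (i : N) :
    iIndepFun (fun k ω => (t k ω i i, u k ω i)) P :=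
  h.indep.comp (fun _ z => (z.1 i i, z.2 i)) fun _ => DataAuction.measurable_value_noise i

variable {δ γ : ℝ} {τ₁ : N → ℝ}

/-- Only nonnegative thresholds are needed. The exceptional null set is where some noise leaves
`[-1, 1]`. -/
lemma IsSampling.ae_isFeasible (h : IsSampling P D t u) (hD : IsRegularPrior E D f) (hδ : 0 < δ)
    (hτ₁ : ∀ i, τ₁ i ∈ Set.Icc (E.lo i i + δ) (E.hi i i - δ)) :
    ∀ᵐ ω ∂P, ∀ k,
      IsFeasible E D (stepMechanism E δ γ τ₁ (fun l => t l ω) (fun l => u l ω) k) := by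
  have := hD.isProb
  have := hD.isProbabilityMeasure_valueLaw
  have hu : ∀ᵐ ω ∂P, ∀ k i, u k ω i ∈ Set.Icc (-1 : ℝ) 1 :=
    ae_all_iff.2 fun k => ae_all_iff.2 fun i =>
      ae_noise_mem (h.measurable_value_noise i) (h.law_value_noise i) k
  filter_upwards [hu] with ω hω k
  refine hD.isFeasible_postedMechanism fun i => (E.lo_nonneg i i).trans ?_
  exact (posted_mem hδ (threshold_mem (γ := γ) (q := fun k ω => (t k ω i i, u k ω i))
    (x := fun k ω => iterate E δ γ τ₁ (fun l => t l ω) (fun l => u l ω) k i)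
    (hτ₁ i) (fun _ => rfl) (fun _ _ => rfl) k ω) (hω k i)).1

/-- The regret of the algorithm, for general parameters. -/
lemma IsSampling.integral_regret_le (h : IsSampling P D t u) (hD : IsRegularPrior E D f)
    (hδ : 0 < δ) (hγ : 0 < γ) (hτ₁ : ∀ i, τ₁ i ∈ Set.Icc (E.lo i i + δ) (E.hi i i - δ))
    {L : N → ℝ} (hL : ∀ i, ∀ v ∈ Set.Icc (E.lo i i) (E.hi i i),
      |virtualDensity (valueLaw D i) (f i) (E.totalExt i) v| ≤ L i)
    {Mstar : Mechanism N} (hM : IsRevenueOptimal E D Mstar) (K : ℕ) :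
    Integrable (fun ω => regret D Mstar
      (stepMechanism E δ γ τ₁ (fun l => t l ω) (fun l => u l ω)) K) P ∧
    ∫ ω, regret D Mstar (stepMechanism E δ γ τ₁ (fun l => t l ω) (fun l => u l ω)) K ∂P
      ≤ ∑ i, (K * (8 * L i * δ + 3 * γ * oracleBound E i ^ 2 / (2 * δ ^ 2))
        + 3 / (2 * γ) * (E.hi i i - E.lo i i) ^ 2) := by
  have := hD.isProb
  have := hD.isProbabilityMeasure_valueLaw
  obtain ⟨θ, hθ, hopt⟩ := hD.exists_optimal_thresholds
  -- All optimal mechanisms earn the same, so the posted one can serve as the benchmark.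
  have hrev : revenue D Mstar
      = ∑ i, (netRevenue (valueLaw D i) (E.totalExt i) (θ i) + E.totalExt i) := by
    rw [← hD.revenue_postedMechanism]
    exact le_antisymm (hopt.2 _ hM.1) (hM.2 _ hopt.1)
  set x : N → ℕ → Ω → ℝ := fun i k ω =>
    iterate E δ γ τ₁ (fun l => t l ω) (fun l => u l ω) k i with hxdef
  set q : N → ℕ → Ω → ℝ × ℝ := fun i k ω => (t k ω i i, u k ω i) with hqdef
  have hx : ∀ i k ω, x i (k + 1) ω = thresholdStep E δ γ i (x i k ω) (q i k ω) :=
    fun _ _ _ => rfl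
  have h0 : ∀ i ω, x i 0 ω = τ₁ i := fun _ _ => rfl
  have hq : ∀ i k, Measurable (q i k) := fun i k => h.measurable_value_noise i k
  have hlaw : ∀ i k, P.map (q i k) = (valueLaw D i).prod unif := fun i k => h.law_value_noise i k
  have hind : ∀ i, iIndepFun (q i) P := fun i => h.iIndepFun_value_noise i
  have hxm : ∀ i k, Measurable (x i k) := fun i k => (indepFun_of_recursion (hq i) (hind i)
    (measurable_thresholdStep E δ γ i) (h0 i) (hx i) k).1
  have hreg : ∀ ω, regret D Mstar (stepMechanism E δ γ τ₁ (fun l => t l ω) (fun l => u l ω)) K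
      = ∑ i, ∑ k ∈ Finset.range K, (netRevenue (valueLaw D i) (E.totalExt i) (θ i)
        - netRevenue (valueLaw D i) (E.totalExt i) (x i k ω + δ * (q i k ω).2)) := by
    intro ω
    rw [Finset.sum_comm, regret]
    refine Finset.sum_congr rfl fun k _ => ?_
    rw [hrev, stepMechanism, hD.revenue_postedMechanism, ← Finset.sum_sub_distrib]
    exact Finset.sum_congr rfl fun i _ => by rw [add_sub_add_right_eq_sub]
  have hint : ∀ i k, Integrable (fun ω => netRevenue (valueLaw D i) (E.totalExt i) (θ i)
        - netRevenue (valueLaw D i) (E.totalExt i) (x i k ω + δ * (q i k ω).2)) P := fun i k =>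
    integrable_netRevenue_posted hδ (hq i) (hlaw i) (hτ₁ i) (h0 i) (hx i) (hxm i) _ _ k
  simp only [hreg]
  refine ⟨integrable_finsetSum _ fun i _ => integrable_finsetSum _ fun k _ => hint i k, ?_⟩
  rw [integral_finsetSum _ fun i _ => integrable_finsetSum _ fun k _ => hint i k]
  refine Finset.sum_le_sum fun i _ => ?_
  rw [integral_finsetSum _ fun k _ => hint i k]
  refine sum_integral_netRevenue_sub_le_of_mem
    (ψ := fun v => -virtualDensity (valueLaw D i) (f i) (E.totalExt i) v) ?_ ?_ hδ hγ (hq i)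
    (hlaw i) (hind i) (hτ₁ i) (h0 i) (hx i) (hθ i) K
  · intro y hy z hz
    have := netRevenue_supergradient (hD.hasDensityOn i) (hD.monotoneOn_virtualDensity i) hy hz
    linarith
  · intro v hv
    rw [abs_neg]
    exact hL i v hv

end Sampling

end DataAuction

end

/-! ### Choice of the parameters and the final rate -/

open DataAuction MeasureTheory in
theorem mainTheorem7 {N : Type*} [Fintype N] [DecidableEq N] (E : Market N) :
    ∃ δ γ : ℕ → ℝ,
      (∀ K, 1 ≤ K → 0 < δ K ∧ 0 < γ K ∧ ∀ i, 2 * δ K ≤ E.hi i i - E.lo i i) ∧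
      ∀ (D : N → Measure (N → ℝ)) (f : N → ℝ → ℝ), IsRegularPrior E D f →
        (∃ Mstar, IsRevenueOptimal E D Mstar) ∧
        ∃ C : ℝ, ∀ K : ℕ, 1 ≤ K → ∀ Mstar, IsRevenueOptimal E D Mstar →
          ∀ τ₁ : N → ℝ, (∀ i, τ₁ i ∈ Set.Icc (E.lo i i + δ K) (E.hi i i - δ K)) →
          ∀ (Ω : Type*) [MeasurableSpace Ω] (P : Measure Ω) [IsProbabilityMeasure P]
            (t : ℕ → Ω → N → N → ℝ) (u : ℕ → Ω → N → ℝ), IsSampling P D t u →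
            let M : Ω → ℕ → Mechanism N := fun ω k =>
              stepMechanism E (δ K) (γ K) τ₁ (fun l => t l ω) (fun l => u l ω) k
            (∀ᵐ ω ∂P, ∀ k, IsFeasible E D (M ω k)) ∧
            Integrable (fun ω => regret D Mstar (M ω) K) P ∧
            ∫ ω, regret D Mstar (M ω) K ∂P ≤ C * (K : ℝ) ^ (3 / 4 : ℝ) := by
  obtain ⟨c, hc, hcE⟩ := E.exists_radius
  have hpos : ∀ K : ℕ, 1 ≤ K → 0 < (K : ℝ) := fun K hK => by exact_mod_cast hK
  -- These exponents balance `K δ`, `K γ / δ²` and `1 / γ`. The factor `c` depends only on the value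
  -- intervals and keeps `2 δ` below every width.
  refine ⟨fun K => c * (K : ℝ) ^ (-(1 / 4) : ℝ), fun K => (K : ℝ) ^ (-(3 / 4) : ℝ),
    fun K hK => ⟨?_, ?_, fun i => ?_⟩, fun D f hD => ⟨?_, ?_⟩⟩
  · exact mul_pos hc (Real.rpow_pos_of_pos (hpos K hK) _)
  · exact Real.rpow_pos_of_pos (hpos K hK) _
  · have : (K : ℝ) ^ (-(1 / 4) : ℝ) ≤ 1 :=
      Real.rpow_le_one_of_one_le_of_nonpos (by exact_mod_cast hK) (by norm_num)
    have := mul_le_of_le_one_right hc.le this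
    linarith [hcE i]
  · obtain ⟨θ, -, hopt⟩ := hD.exists_optimal_thresholds
    exact ⟨_, hopt⟩
  · set L : N → ℝ := fun i =>
      |virtualDensity (valueLaw D i) (f i) (E.totalExt i) (E.lo i i)|
        + |virtualDensity (valueLaw D i) (f i) (E.totalExt i) (E.hi i i)|
    refine ⟨∑ i, (8 * L i * c + 3 * oracleBound E i ^ 2 / (2 * c ^ 2)
      + 3 / 2 * (E.hi i i - E.lo i i) ^ 2), fun K hK Mstar hM τ₁ hτ₁ Ω _ P _ t u h => ?_⟩
    have hδ : 0 < c * (K : ℝ) ^ (-(1 / 4) : ℝ) :=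
      mul_pos hc (Real.rpow_pos_of_pos (hpos K hK) _)
    have hγ : 0 < (K : ℝ) ^ (-(3 / 4) : ℝ) := Real.rpow_pos_of_pos (hpos K hK) _
    have hreg := h.integral_regret_le hD hδ hγ hτ₁ (L := L) (fun i v hv =>
      abs_virtualDensity_le (E.val_lt i).le (hD.monotoneOn_virtualDensity i) hv) hM K
    refine ⟨h.ae_isFeasible hD hδ hτ₁, hreg.1, hreg.2.trans_eq ?_⟩
    rw [Finset.sum_mul]
    refine Finset.sum_congr rfl fun i _ => ?_
    -- In terms of `r` all powers of `K` are integral, and each of the three terms is a multiple of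
    -- `r ^ 3`.
    set r : ℝ := (K : ℝ) ^ (1 / 4 : ℝ) with hr
    have hr0 : 0 < r := Real.rpow_pos_of_pos (hpos K hK) _
    have e1 : (K : ℝ) ^ (-(1 / 4) : ℝ) = r⁻¹ := Real.rpow_neg (hpos K hK).le _
    have e3 : (K : ℝ) ^ (3 / 4 : ℝ) = r ^ 3 := by
      rw [hr, ← Real.rpow_natCast, ← Real.rpow_mul (hpos K hK).le]; norm_num
    have e2 : (K : ℝ) ^ (-(3 / 4) : ℝ) = (r ^ 3)⁻¹ := by
      rw [Real.rpow_neg (hpos K hK).le, e3]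
    have e4 : (K : ℝ) = r ^ 4 := by
      rw [hr, ← Real.rpow_natCast, ← Real.rpow_mul (hpos K hK).le]; norm_num
    rw [e1, e2, e3]
    conv_lhs => rw [e4]
    field_simp
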